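/- Let $k$ be an algebraically closed field of characteristic zero. For a commutative (unital) $k$-algebra $A$: * Let $LA=\bigoplus_{n\ge0}L_nA$ be the free Lie algebra on the $k$-vector space $A$, graded by $L_0A=A$, $L_{n+1}A=[L_0A,L_nA]$, and let $L_+A=\bigoplus_{n\ge1}L_nA$. The symmetric algebra $SLA$ is a Poisson algebra for the bracket extending the Lie bracket. The Poisson envelope of $A$ is $PA=SLA/\langle\langle IA\rangle\rangle$, where $IA=\ker(SA\to A)$ and $\langle\langle IA\rangle\rangle$ is the Poisson ideal of $SLA$ generated by $IA\subset SA\subset SLA$; it contains $A$, and it is graded, $PA=\bigoplus_q P_qA$, by the grading induced by that of $LA$. * For $n\ge0$ let $\mathcal H^n\subset PA$ be the image of $\bigoplus_{p\ge n}SA\otimes S^pL_+A\subset SLA$ (the filtration by symmetric-power degree in $L_+A$), and let $GPA=\bigoplus_{p\ge0}\mathcal H^p/\mathcal H^{p+1}$ be the associated graded algebra. It is bigraded, $GPA=\bigoplus_{p,q\ge0}G^p_qPA$, where $G^p_qPA$ is the image of $\mathcal H^p\cap P_qA$ in $\mathcal H^p/\mathcal H^{p+1}$. * Let $\Omega^1_A$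 be the module of Kähler differentials of $A$ over $k$, let $L^A\Omega^1_A=\bigoplus_{n\ge0}L^A_n\Omega^1_A$ be the free $A$-Lie algebra on the $A$-module $\Omega^1_A$, graded in the same way, and let $L^A_+\Omega^1_A=\bigoplus_{n\ge1}L^A_n\Omega^1_A$. The symmetric $A$-algebra $S^AL^A_+\Omega^1_A$ is bigraded by the symmetric power $p$ and by the degree $q$ induced by the grading of $L^A_+\Omega^1_A$. Theorem. For every commutative $k$-algebra $A$ there is a surjective homomorphism of bigraded $A$-algebras $$\phi_A:S^AL^A_+\Omega^1_A\twoheadrightarrow GPA,$$ natural in $A$, which for all $n\ge1$ and $a_0,\dots,a_n\in A$ sends $[da_0,[da_1,\dots,[da_{n-1},da_n]\dots]]$ to the class of $\{a_0,\{a_1,\dots,\{a_{n-1},a_n\}\dots\}\}$ in $\mathcal H^1/\mathcal H^2$. If $A$ is smooth (formally smooth and essentially of finite type over $k$), then $\phi_A$ is an isomorphism. -/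

import Mathlib

open scoped DirectSum KaehlerDifferential

universe u v

noncomputable section

/-! ### Free Lie algebras on modules -/

/-- The Lie ideal of the free Lie algebra on the set `M` that expresses the linearity of the
generators. -/
def FreeLie.relIdeal (R M : Type*) [CommRing R] [AddCommGroup M] [Module R M] :
    LieIdeal R (FreeLieAlgebra R M) :=
  LieSubmodule.lieSpan R (FreeLieAlgebra R M)
    ({z | ∃ x y : M, z = FreeLieAlgebra.of R (x + y) - FreeLieAlgebra.of R x
        - FreeLieAlgebra.of R y} ∪
      {z | ∃ (r : R) (x : M), z = FreeLieAlgebra.of R (r • x) - r • FreeLieAlgebra.of R x})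

/-- The free `R`-Lie algebra on an `R`-module `M`: the universal `R`-Lie algebra that receives
an `R`-linear map from `M`. -/
def FreeLie (R M : Type*) [CommRing R] [AddCommGroup M] [Module R M] : Type _ :=
  FreeLieAlgebra R M ⧸ FreeLie.relIdeal R M

namespace FreeLie

section basic

variable (R M : Type*) [CommRing R] [AddCommGroup M] [Module R M]

instance : LieRing (FreeLie R M) :=
  inferInstanceAs (LieRing (FreeLieAlgebra R M ⧸ relIdeal R M))

instance : LieAlgebra R (FreeLie R M) :=
  inferInstanceAs (LieAlgebra R (FreeLieAlgebra R M ⧸ relIdeal R M))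

/-- The quotient map from the free Lie algebra on the underlying set. -/
def mk : FreeLieAlgebra R M →ₗ⁅R⁆ FreeLie R M where
  toFun x := (relIdeal R M).toSubmodule.mkQ x
  map_add' _ _ := rfl
  map_smul' _ _ := rfl
  map_lie' := rfl

/-- The universal linear map `M → FreeLie R M`. -/
def ι : M →ₗ[R] FreeLie R M where
  toFun x := mk R M (FreeLieAlgebra.of R x)
  map_add' x y := by
    rw [← map_add, ← sub_eq_zero, ← map_sub, ← sub_sub]
    exact (Submodule.Quotient.mk_eq_zero _).2
      (LieSubmodule.subset_lieSpan (Or.inl ⟨x, y, rfl⟩))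
  map_smul' r x := by
    rw [RingHom.id_apply, ← map_smul, ← sub_eq_zero, ← map_sub]
    exact (Submodule.Quotient.mk_eq_zero _).2
      (LieSubmodule.subset_lieSpan (Or.inr ⟨r, x, rfl⟩))

theorem mk_surjective : Function.Surjective (mk R M) := Submodule.mkQ_surjective _

/-- The homogeneous components: degree `0` is the image of `M`, and
`L_{n+1} = [L_0, L_n]`. -/
def deg : ℕ → Submodule R (FreeLie R M)
  | 0 => LinearMap.range (ι R M)
  | n + 1 => Submodule.span R {z | ∃ m : M, ∃ y ∈ deg n, z = ⁅ι R M m, y⁆}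

theorem deg_zero : deg R M 0 = LinearMap.range (ι R M) := rfl

theorem deg_succ (n : ℕ) : deg R M (n + 1) =
    Submodule.span R {z | ∃ m : M, ∃ y ∈ deg R M n, z = ⁅ι R M m, y⁆} := rfl

theorem ι_mem_deg (x : M) : ι R M x ∈ deg R M 0 := by
  rw [deg_zero]
  exact LinearMap.mem_range_self _ x

/-- The submodule `L_+`, the sum of the components of positive degree. -/
def plus : Submodule R (FreeLie R M) := ⨆ n : ℕ, deg R M (n + 1)

/-- The component of degree `n` of `L_+`. -/
def plusDeg (n : ℕ) : Submodule R (plus R M) := (deg R M n).comap (plus R M).subtype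

end basic

variable {R M : Type*} [CommRing R] [AddCommGroup M] [Module R M]

/-- The right-nested bracket `[d a₀, [d a₁, […, d aₙ]…]]` of the images of the entries of a
nonempty list under a map `d`. -/
def nested {X : Type*} (d : X → M) : X → List X → FreeLie R M
  | a, [] => ι R M (d a)
  | a, b :: l => ⁅ι R M (d a), nested d b l⁆

theorem nested_mem_deg {X : Type*} (d : X → M) (a : X) (l : List X) :
    nested (R := R) d a l ∈ deg R M l.length := by
  induction l generalizing a with
  | nil => exact ι_mem_deg R M (d a)
  | cons b l ih => exact Submodule.subset_span ⟨d a, _, ih b, rfl⟩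

theorem nested_mem_plus {X : Type*} (d : X → M) (a b : X) (l : List X) :
    nested (R := R) d a (b :: l) ∈ plus R M :=
  Submodule.mem_iSup_of_mem l.length (nested_mem_deg d a (b :: l))

section lift

variable {L : Type*} [LieRing L] [LieAlgebra R L] (f : M →ₗ[R] L)

/-- The extension of a linear map to a homomorphism of Lie algebras. -/
def lift : FreeLie R M →ₗ⁅R⁆ L :=
  { Submodule.liftQ (relIdeal R M).toSubmodule
      (FreeLieAlgebra.lift R (f : M → L) : FreeLieAlgebra R M →ₗ[R] L) (by
        have h : relIdeal R M ≤ (FreeLieAlgebra.lift R (f : M → L)).ker := by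
          rw [relIdeal, LieSubmodule.lieSpan_le]
          rintro z (⟨x, y, rfl⟩ | ⟨r, x, rfl⟩) <;> simp
        intro x hx
        exact LieHom.mem_ker.1 (h hx)) with
    map_lie' := by
      intro x y
      obtain ⟨x, rfl⟩ := mk_surjective R M x
      obtain ⟨y, rfl⟩ := mk_surjective R M y
      exact LieHom.map_lie (FreeLieAlgebra.lift R (f : M → L)) x y }

theorem lift_ι (x : M) : lift f (ι R M x) = f x :=
  FreeLieAlgebra.lift_of_apply (f : M → L) x

end lift

section map

variable {R' M' : Type*} [CommRing R'] [AddCommGroup M'] [Module R' M'] {σ : R →+* R'}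

/-- Functoriality: a `σ`-semilinear map induces a `σ`-semilinear map of free Lie algebras. -/
def map (g : M →ₛₗ[σ] M') : FreeLie R M →ₛₗ[σ] FreeLie R' M' :=
  letI : Algebra R R' := σ.toAlgebra
  let h : FreeLie R M →ₗ⁅R⁆ RestrictScalars R R' (FreeLie R' M') :=
    lift (L := RestrictScalars R R' (FreeLie R' M'))
      { toFun := fun x => (RestrictScalars.addEquiv R R' _).symm (ι R' M' (g x))
        map_add' := fun x y => by simp
        map_smul' := fun r x => by simp; rfl }
  { toFun := fun x => RestrictScalars.addEquiv R R' _ (h x)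
    map_add' := fun x y => by simp
    map_smul' := fun r x => by rw [map_smul]; rfl }

theorem map_ι (g : M →ₛₗ[σ] M') (x : M) : map g (ι R M x) = ι R' M' (g x) := by
  let _ : Algebra R R' := σ.toAlgebra
  exact lift_ι (L := RestrictScalars R R' (FreeLie R' M')) _ x

theorem map_lie (g : M →ₛₗ[σ] M') (x y : FreeLie R M) : map g ⁅x, y⁆ = ⁅map g x, map g y⁆ := by
  let _ : Algebra R R' := σ.toAlgebra
  exact LieHom.map_lie (lift (L := RestrictScalars R R' (FreeLie R' M')) _) x y

theorem map_mem_deg (g : M →ₛₗ[σ] M') (n : ℕ) {x : FreeLie R M} (hx : x ∈ deg R M n) :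
    map g x ∈ deg R' M' n := by
  induction n generalizing x with
  | zero =>
    rw [deg_zero, LinearMap.mem_range] at hx
    obtain ⟨y, rfl⟩ := hx
    rw [map_ι]
    exact ι_mem_deg R' M' (g y)
  | succ n ih =>
    have : deg R M (n + 1) ≤ (deg R' M' (n + 1)).comap (map g) := by
      rw [deg_succ, Submodule.span_le]
      rintro _ ⟨m, y, hy, rfl⟩
      refine Submodule.subset_span ⟨g m, _, ih hy, ?_⟩
      rw [map_lie, map_ι]
    exact this hx

/-- The restriction of `map g` to `L_+`. -/
def plusMap (g : M →ₛₗ[σ] M') : plus R M →ₛₗ[σ] plus R' M' :=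
  (map g).restrict (p := plus R M) (q := plus R' M') (by
    have : plus R M ≤ (plus R' M').comap (map g) :=
      iSup_le fun n x hx => Submodule.mem_iSup_of_mem n (map_mem_deg g (n + 1) hx)
    exact fun x hx => this hx)

end map

end FreeLie

/-! ### Bigradings on symmetric algebras -/

namespace SymmetricAlgebra

variable {R M : Type*} [CommRing R] [AddCommGroup M] [Module R M]

/-- Let `M` carry a family of submodules `𝓜 d` and let `w : ℕ → ℕ` be a weight. This is the span of
all products `m₁ ⋯ mᵣ` with `mᵢ ∈ 𝓜 dᵢ`, of total weight `∑ w dᵢ = p` and total degree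
`∑ dᵢ = q`. -/
def bideg (𝓜 : ℕ → Submodule R M) (w : ℕ → ℕ) (p q : ℕ) : Submodule R (SymmetricAlgebra R M) :=
  Submodule.span R {x | ∃ l : List (ℕ × M), (∀ z ∈ l, z.2 ∈ 𝓜 z.1) ∧
    (l.map fun z => w z.1).sum = p ∧ (l.map fun z => z.1).sum = q ∧
    x = (l.map fun z => ι R M z.2).prod}

theorem bideg_mul {𝓜 : ℕ → Submodule R M} {w : ℕ → ℕ} {p q p' q' : ℕ}
    {x y : SymmetricAlgebra R M} (hx : x ∈ bideg 𝓜 w p q) (hy : y ∈ bideg 𝓜 w p' q') :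
    x * y ∈ bideg 𝓜 w (p + p') (q + q') := by
  have := Submodule.mul_mem_mul hx hy
  rw [bideg, bideg, Submodule.span_mul_span] at this
  refine Submodule.span_mono ?_ this
  rintro _ ⟨_, ⟨l, hl, rfl, rfl, rfl⟩, _, ⟨l', hl', rfl, rfl, rfl⟩, rfl⟩
  refine ⟨l ++ l', ?_, by simp, by simp, by simp⟩
  intro z hz
  rcases List.mem_append.1 hz with h | h
  exacts [hl z h, hl' z h]

theorem one_mem_bideg (𝓜 : ℕ → Submodule R M) (w : ℕ → ℕ) : 1 ∈ bideg 𝓜 w 0 0 :=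
  Submodule.subset_span ⟨[], by simp, by simp, by simp, by simp⟩

theorem ι_mem_bideg {𝓜 : ℕ → Submodule R M} {w : ℕ → ℕ} {p d : ℕ} (hp : w d = p) {m : M}
    (hm : m ∈ 𝓜 d) : ι R M m ∈ bideg 𝓜 w p d :=
  Submodule.subset_span ⟨[(d, m)], by simpa using hm, by simpa using hp, by simp, by simp⟩

variable {R' M' : Type*} [CommRing R'] [AddCommGroup M'] [Module R' M'] {σ : R →+* R'}

/-- Functoriality: a `σ`-semilinear map induces a ring homomorphism of symmetric algebras. -/
def mapSemilinear (g : M →ₛₗ[σ] M') : SymmetricAlgebra R M →+* SymmetricAlgebra R' M' :=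
  letI : Algebra R (SymmetricAlgebra R' M') := Algebra.compHom _ σ
  (lift (R := R) (A := SymmetricAlgebra R' M')
    { toFun := fun x => ι R' M' (g x)
      map_add' := fun x y => by simp
      map_smul' := fun r x => by rw [map_smulₛₗ, map_smul]; rfl }).toRingHom

theorem mapSemilinear_ι (g : M →ₛₗ[σ] M') (x : M) :
    mapSemilinear g (ι R M x) = ι R' M' (g x) := by
  let _ : Algebra R (SymmetricAlgebra R' M') := Algebra.compHom _ σ
  exact lift_ι_apply (R := R) (A := SymmetricAlgebra R' M') _ x

theorem mapSemilinear_algebraMap (g : M →ₛₗ[σ] M') (r : R) :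
    mapSemilinear g (algebraMap R _ r) = algebraMap R' _ (σ r) := by
  let _ : Algebra R (SymmetricAlgebra R' M') := Algebra.compHom _ σ
  exact (lift (R := R) (A := SymmetricAlgebra R' M') _).commutes r

theorem mapSemilinear_mem_bideg (g : M →ₛₗ[σ] M') {𝓜 : ℕ → Submodule R M}
    {𝓜' : ℕ → Submodule R' M'} (h : ∀ n, ∀ m ∈ 𝓜 n, g m ∈ 𝓜' n) (w : ℕ → ℕ) {p q : ℕ}
    {x : SymmetricAlgebra R M} (hx : x ∈ bideg 𝓜 w p q) :
    mapSemilinear g x ∈ bideg 𝓜' w p q := by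
  induction hx using Submodule.span_induction with
  | mem x hx =>
    obtain ⟨l, hl, rfl, rfl, rfl⟩ := hx
    refine Submodule.subset_span ⟨l.map fun z => (z.1, g z.2), ?_, ?_, ?_, ?_⟩
    · intro z hz
      obtain ⟨y, hy, rfl⟩ := List.mem_map.1 hz
      exact h _ _ (hl y hy)
    · simp [Function.comp_def]
    · simp [Function.comp_def]
    · simp [Function.comp_def, map_list_prod, mapSemilinear_ι]
  | zero => simp
  | add x y _ _ hx hy => rw [map_add]; exact add_mem hx hy
  | smul r x _ hx =>
    rw [Algebra.smul_def, map_mul, mapSemilinear_algebraMap, ← Algebra.smul_def]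
    exact Submodule.smul_mem _ _ hx

end SymmetricAlgebra

section

/-! ### Poisson algebras -/

/-- A Poisson algebra over `k`: a commutative `k`-algebra with a `k`-Lie bracket that is a
derivation in each variable. -/
class PoissonAlgebra (k P : Type*) [CommRing k] [CommRing P] [Algebra k P] where
  /-- The Poisson bracket. -/
  bracket : P →ₗ[k] P →ₗ[k] P
  bracket_self : ∀ x, bracket x x = 0
  jacobi : ∀ x y z,
    bracket x (bracket y z) = bracket (bracket x y) z + bracket y (bracket x z)
  leibniz : ∀ x y z, bracket x (y * z) = bracket x y * z + y * bracket x z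

namespace SymmetricAlgebra

section poisson
variable {k M : Type*} [CommRing k] [AddCommGroup M] [Module k M]

open TrivSqZeroExt in
/-- The algebra homomorphism `S(M) → S(M)[ε]`, `m ↦ m + ε h(m)`. -/
def toDual (h : M →ₗ[k] SymmetricAlgebra k M) :
    SymmetricAlgebra k M →ₐ[k] TrivSqZeroExt (SymmetricAlgebra k M) (SymmetricAlgebra k M) :=
  lift ((inlAlgHom k (SymmetricAlgebra k M) (SymmetricAlgebra k M)).toLinearMap ∘ₗ ι k M +
    (inrHom (SymmetricAlgebra k M) (SymmetricAlgebra k M)).restrictScalars k ∘ₗ h)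

theorem toDual_fst (h : M →ₗ[k] SymmetricAlgebra k M) (x : SymmetricAlgebra k M) :
    (toDual h x).fst = x := by
  have : (TrivSqZeroExt.fstHom k (SymmetricAlgebra k M) (SymmetricAlgebra k M)).comp (toDual h)
      = AlgHom.id k _ := by
    apply algHom_ext
    ext m
    simp [toDual]
  exact DFunLike.congr_fun this x

/-- The derivation of `S(M)` that extends a linear map `h : M → S(M)`. -/
def extendDer (h : M →ₗ[k] SymmetricAlgebra k M) :
    Derivation k (SymmetricAlgebra k M) (SymmetricAlgebra k M) :=
  Derivation.mk' ((TrivSqZeroExt.sndHom (SymmetricAlgebra k M) (SymmetricAlgebra k M)).restrictScalars k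
    ∘ₗ (toDual h).toLinearMap) (by
      intro a b
      simp [toDual_fst, mul_comm])

theorem extendDer_ι (h : M →ₗ[k] SymmetricAlgebra k M) (m : M) :
    extendDer h (ι k M m) = h m := by
  simp [extendDer, toDual]

theorem derivation_ext {D E : Derivation k (SymmetricAlgebra k M) (SymmetricAlgebra k M)}
    (h : ∀ m, D (ι k M m) = E (ι k M m)) : D = E := by
  ext x
  induction x using SymmetricAlgebra.induction with
  | algebraMap r => simp
  | ι m => exact h m
  | mul a b ha hb => simp [ha, hb]
  | add a b ha hb => simp [ha, hb]

variable {𝔤 : Type*} [LieRing 𝔤] [LieAlgebra k 𝔤]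

/-- The derivation `{x, ·}` of `S(𝔤)` for `x` in `𝔤`. -/
def adDer : 𝔤 →ₗ[k] Derivation k (SymmetricAlgebra k 𝔤) (SymmetricAlgebra k 𝔤) where
  toFun x := extendDer (ι k 𝔤 ∘ₗ LieAlgebra.ad k 𝔤 x)
  map_add' x y := derivation_ext fun m => by simp [extendDer_ι]
  map_smul' r x := derivation_ext fun m => by simp [extendDer_ι]

/-- The derivation `{·, b}` of `S(𝔤)`. -/
def bracketRight : SymmetricAlgebra k 𝔤 →ₗ[k]
    Derivation k (SymmetricAlgebra k 𝔤) (SymmetricAlgebra k 𝔤) where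
  toFun b := extendDer
    { toFun := fun x => adDer x b
      map_add' := fun x y => by simp
      map_smul' := fun r x => by simp }
  map_add' x y := derivation_ext fun m => by simp [extendDer_ι]
  map_smul' r x := derivation_ext fun m => by simp [extendDer_ι]

theorem bracketRight_ι (b : SymmetricAlgebra k 𝔤) (x : 𝔤) :
    bracketRight b (ι k 𝔤 x) = adDer x b := extendDer_ι _ x

theorem adDer_ι (x y : 𝔤) : adDer x (ι k 𝔤 y) = ι k 𝔤 ⁅x, y⁆ := extendDer_ι _ y

theorem bracketRight_mul (a b c : SymmetricAlgebra k 𝔤) :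
    bracketRight (a * b) c = a * bracketRight b c + b * bracketRight a c := by
  induction c using SymmetricAlgebra.induction with
  | algebraMap r => simp
  | ι m => simp [bracketRight_ι]
  | mul c d hc hd => simp [hc, hd]; ring
  | add c d hc hd => simp [hc, hd]; ring

/-- The bracket `{·, ·}` of `S(𝔤)`. -/
def lieBracket : SymmetricAlgebra k 𝔤 →ₗ[k] SymmetricAlgebra k 𝔤 →ₗ[k] SymmetricAlgebra k 𝔤 :=
  LinearMap.mk₂ k (fun a b => bracketRight b a) (by simp) (by simp) (by simp) (by simp)

theorem lieBracket_ι (x y : 𝔤) : lieBracket (ι k 𝔤 x) (ι k 𝔤 y) = ι k 𝔤 ⁅x, y⁆ := by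
  simp [lieBracket, bracketRight_ι, adDer_ι]

theorem lieBracket_mul_left (a b c : SymmetricAlgebra k 𝔤) :
    lieBracket (a * b) c = a * lieBracket b c + b * lieBracket a c := by
  simp [lieBracket]

theorem lieBracket_mul_right (a b c : SymmetricAlgebra k 𝔤) :
    lieBracket a (b * c) = lieBracket a b * c + b * lieBracket a c := by
  simp only [lieBracket, LinearMap.mk₂_apply, bracketRight_mul]; ring

theorem lieBracket_algebraMap_left (r : k) (c : SymmetricAlgebra k 𝔤) :
    lieBracket (algebraMap k _ r) c = 0 := by
  simp [lieBracket]

theorem lieBracket_algebraMap_right (r : k) (c : SymmetricAlgebra k 𝔤) :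
    lieBracket c (algebraMap k _ r) = 0 := by
  have h : lieBracket c (1 : SymmetricAlgebra k 𝔤) = 0 := by
    have := lieBracket_mul_right c 1 1
    simpa using this
  rw [Algebra.algebraMap_eq_smul_one, map_smul, h, smul_zero]

theorem lieBracket_skew (a b : SymmetricAlgebra k 𝔤) : lieBracket a b = -lieBracket b a := by
  induction a using SymmetricAlgebra.induction with
  | algebraMap r => simp [lieBracket_algebraMap_left, lieBracket_algebraMap_right]
  | ι x =>
    induction b using SymmetricAlgebra.induction with
    | algebraMap r => simp [lieBracket_algebraMap_left, lieBracket_algebraMap_right]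
    | ι y => rw [lieBracket_ι, lieBracket_ι, ← map_neg, lie_skew]
    | mul b c hb hc => rw [lieBracket_mul_left, lieBracket_mul_right, hb, hc]; ring
    | add b c hb hc => simp only [map_add, LinearMap.add_apply, hb, hc]; ring
  | mul a c ha hc => rw [lieBracket_mul_left, lieBracket_mul_right, ha, hc]; ring
  | add a c ha hc => simp only [map_add, LinearMap.add_apply, ha, hc]; ring

theorem lieBracket_self (a : SymmetricAlgebra k 𝔤) : lieBracket a a = 0 := by
  induction a using SymmetricAlgebra.induction with
  | algebraMap r => exact lieBracket_algebraMap_left r _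
  | ι x => rw [lieBracket_ι, lie_self, map_zero]
  | mul a c ha hc =>
    rw [lieBracket_mul_left, lieBracket_mul_right, lieBracket_mul_right, ha, hc,
      lieBracket_skew c a]
    ring
  | add a c ha hc =>
    simp only [map_add, LinearMap.add_apply, ha, hc]
    rw [lieBracket_skew c a]
    ring

theorem lieBracket_jacobi (x y z : SymmetricAlgebra k 𝔤) :
    lieBracket x (lieBracket y z) =
      lieBracket (lieBracket x y) z + lieBracket y (lieBracket x z) := by
  induction x using SymmetricAlgebra.induction with
  | algebraMap r => simp [lieBracket_algebraMap_left]
  | ι u =>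
    induction y using SymmetricAlgebra.induction with
    | algebraMap r => simp [lieBracket_algebraMap_left, lieBracket_algebraMap_right]
    | ι v =>
      induction z using SymmetricAlgebra.induction with
      | algebraMap r => simp [lieBracket_algebraMap_right]
      | ι w => simp only [lieBracket_ι, ← map_add, leibniz_lie u v w]
      | mul a b ha hb =>
        simp only [lieBracket_mul_right, map_add, ha, hb]; ring
      | add a b ha hb => simp only [map_add, ha, hb]; ring
    | mul a b ha hb =>
      simp only [lieBracket_mul_right, lieBracket_mul_left, map_add, LinearMap.add_apply, ha, hb]
      ring
    | add a b ha hb => simp only [map_add, LinearMap.add_apply, ha, hb]; ring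
  | mul a b ha hb =>
    simp only [lieBracket_mul_right, lieBracket_mul_left, map_add, LinearMap.add_apply, ha, hb]
    rw [lieBracket_skew y a, lieBracket_skew y b]
    ring
  | add a b ha hb => simp only [map_add, LinearMap.add_apply, ha, hb]; ring

/-- The symmetric algebra of a Lie algebra is a Poisson algebra; the bracket extends the Lie
bracket. -/
instance : PoissonAlgebra k (SymmetricAlgebra k 𝔤) where
  bracket := lieBracket
  bracket_self := lieBracket_self
  jacobi := lieBracket_jacobi
  leibniz := lieBracket_mul_right

end poisson

end SymmetricAlgebra

namespace PoissonAlgebra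

section ideals

variable (k : Type*) {P : Type*} [CommRing k] [CommRing P] [Algebra k P] [PoissonAlgebra k P]

/-- An ideal of a Poisson algebra is a Poisson ideal if it is also an ideal for the bracket. -/
def IsPoissonIdeal (I : Ideal P) : Prop := ∀ a : P, ∀ x ∈ I, bracket (k := k) a x ∈ I

/-- The smallest Poisson ideal that contains a set. -/
def poissonSpan (Y : Set P) : Ideal P := sInf {I | IsPoissonIdeal k I ∧ Y ⊆ I}

theorem subset_poissonSpan (Y : Set P) : Y ⊆ poissonSpan k Y := fun _ hy =>
  Submodule.mem_sInf.2 fun _ hI => hI.2 hy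

theorem poissonSpan_le {Y : Set P} {I : Ideal P} (hI : IsPoissonIdeal k I) (hY : Y ⊆ I) :
    poissonSpan k Y ≤ I := sInf_le ⟨hI, hY⟩

theorem isPoissonIdeal_poissonSpan (Y : Set P) : IsPoissonIdeal k (poissonSpan k Y) :=
  fun a x hx => Submodule.mem_sInf.2 fun _ hI => hI.1 a x (Submodule.mem_sInf.1 hx _ hI)

theorem bracket_skew (a b : P) : bracket (k := k) a b = -bracket (k := k) b a := by
  have h := bracket_self (k := k) (a + b)
  simp only [map_add, LinearMap.add_apply, bracket_self, zero_add, add_zero] at h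
  exact eq_neg_of_add_eq_zero_right h

theorem mk_bracket_eq {I : Ideal P} (hI : IsPoissonIdeal k I) {a a' b b' : P}
    (ha : a - a' ∈ I) (hb : b - b' ∈ I) :
    Ideal.Quotient.mk I (bracket (k := k) a b) = Ideal.Quotient.mk I (bracket (k := k) a' b') := by
  rw [Ideal.Quotient.eq]
  have h : bracket (k := k) a b - bracket (k := k) a' b' =
      bracket (k := k) a (b - b') - bracket (k := k) b' (a - a') := by
    rw [map_sub, map_sub, bracket_skew k b' a, bracket_skew k b' a']
    ring
  rw [h]
  exact I.sub_mem (hI _ _ hb) (hI _ _ ha)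

/-- The bracket on the quotient by a Poisson ideal. -/
def quotientBracket {I : Ideal P} (hI : IsPoissonIdeal k I) : P ⧸ I →ₗ[k] P ⧸ I →ₗ[k] P ⧸ I :=
  LinearMap.mk₂ k
    (fun x y => Quotient.liftOn₂' x y (fun a b => Ideal.Quotient.mk I (bracket (k := k) a b))
      (fun _ _ _ _ h h' => mk_bracket_eq k hI ((Submodule.quotientRel_def _).1 h)
        ((Submodule.quotientRel_def _).1 h')))
    (by
      rintro ⟨a⟩ ⟨b⟩ ⟨c⟩
      change Ideal.Quotient.mk I (bracket (k := k) (a + b) c) =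
        Ideal.Quotient.mk I (bracket (k := k) a c) + Ideal.Quotient.mk I (bracket (k := k) b c)
      rw [map_add, LinearMap.add_apply, map_add])
    (by
      rintro r ⟨a⟩ ⟨b⟩
      change Ideal.Quotient.mk I (bracket (k := k) (r • a) b) =
        r • Ideal.Quotient.mk I (bracket (k := k) a b)
      rw [map_smul, LinearMap.smul_apply]
      rfl)
    (by
      rintro ⟨a⟩ ⟨b⟩ ⟨c⟩
      change Ideal.Quotient.mk I (bracket (k := k) a (b + c)) =
        Ideal.Quotient.mk I (bracket (k := k) a b) + Ideal.Quotient.mk I (bracket (k := k) a c)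
      rw [map_add, map_add])
    (by
      rintro r ⟨a⟩ ⟨b⟩
      change Ideal.Quotient.mk I (bracket (k := k) a (r • b)) =
        r • Ideal.Quotient.mk I (bracket (k := k) a b)
      rw [map_smul]
      rfl)

theorem quotientBracket_mk {I : Ideal P} (hI : IsPoissonIdeal k I) (a b : P) :
    quotientBracket k hI (Ideal.Quotient.mk I a) (Ideal.Quotient.mk I b) =
      Ideal.Quotient.mk I (bracket (k := k) a b) := rfl

/-- The quotient of a Poisson algebra by a Poisson ideal. -/
abbrev quotient {I : Ideal P} (hI : IsPoissonIdeal k I) : PoissonAlgebra k (P ⧸ I) where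
  bracket := quotientBracket k hI
  bracket_self x := by
    obtain ⟨x, rfl⟩ := Ideal.Quotient.mk_surjective x
    rw [quotientBracket_mk, bracket_self, map_zero]
  jacobi x y z := by
    obtain ⟨x, rfl⟩ := Ideal.Quotient.mk_surjective x
    obtain ⟨y, rfl⟩ := Ideal.Quotient.mk_surjective y
    obtain ⟨z, rfl⟩ := Ideal.Quotient.mk_surjective z
    simp only [quotientBracket_mk, ← map_add, jacobi x y z]
  leibniz x y z := by
    obtain ⟨x, rfl⟩ := Ideal.Quotient.mk_surjective x
    obtain ⟨y, rfl⟩ := Ideal.Quotient.mk_surjective y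
    obtain ⟨z, rfl⟩ := Ideal.Quotient.mk_surjective z
    simp only [quotientBracket_mk, ← map_mul, ← map_add, leibniz x y z]

end ideals

end PoissonAlgebra

end

/-! ### The associated graded algebra of a descending filtration -/

/-- A descending multiplicative filtration by `A`-submodules of an `A`-algebra. -/
class IsDescendingFiltration {A P : Type*} [CommRing A] [CommRing P] [Algebra A P]
    (F : ℕ → Submodule A P) : Prop where
  succ_le : ∀ n, F (n + 1) ≤ F n
  one_mem : 1 ∈ F 0
  mul_mem : ∀ {m n : ℕ} {x y : P}, x ∈ F m → y ∈ F n → x * y ∈ F (m + n)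

namespace AssocGraded

section

variable {A P : Type*} [CommRing A] [CommRing P] [Algebra A P] (F : ℕ → Submodule A P)

/-- The quotient `F n / F (n + 1)`. -/
def Piece (n : ℕ) : Type _ := F n ⧸ (F (n + 1)).comap (F n).subtype

instance (n : ℕ) : AddCommGroup (Piece F n) :=
  inferInstanceAs (AddCommGroup (F n ⧸ (F (n + 1)).comap (F n).subtype))

instance (n : ℕ) : Module A (Piece F n) :=
  inferInstanceAs (Module A (F n ⧸ (F (n + 1)).comap (F n).subtype))

/-- The class of an element of `F n` in `F n / F (n + 1)`. -/
def toPiece (n : ℕ) : F n →ₗ[A] Piece F n := Submodule.mkQ ((F (n + 1)).comap (F n).subtype)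

theorem toPiece_surjective (n : ℕ) : Function.Surjective (toPiece F n) :=
  Submodule.mkQ_surjective _

variable {F} in
theorem toPiece_eq_zero {n : ℕ} {x : F n} : toPiece F n x = 0 ↔ (x : P) ∈ F (n + 1) :=
  Submodule.Quotient.mk_eq_zero _

theorem gradedMonoid_mk_eq {i j : ℕ} (h : i = j) {x : F i} {y : F j} (hxy : (x : P) = y) :
    GradedMonoid.mk (A := Piece F) i (toPiece F i x) = GradedMonoid.mk j (toPiece F j y) := by
  subst h
  rw [Subtype.ext hxy]

variable [hF : IsDescendingFiltration F]

/-- Multiplication `F i × F j → F (i + j) / F (i + j + 1)`. -/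
def preMul (i j : ℕ) : F i →ₗ[A] F j →ₗ[A] Piece F (i + j) :=
  LinearMap.mk₂ A (fun x y => toPiece F (i + j) ⟨x * y, hF.mul_mem x.2 y.2⟩)
    (fun x x' y => by
      rw [← map_add]
      exact congrArg _ (Subtype.ext (add_mul _ _ _)))
    (fun r x y => by
      rw [← map_smul]
      exact congrArg _ (Subtype.ext (smul_mul_assoc _ _ _)))
    (fun x y y' => by
      rw [← map_add]
      exact congrArg _ (Subtype.ext (mul_add _ _ _)))
    (fun r x y => by
      rw [← map_smul]
      exact congrArg _ (Subtype.ext (mul_smul_comm _ _ _)))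

/-- The induced multiplication on the quotients. -/
def pieceMul (i j : ℕ) : Piece F i →ₗ[A] Piece F j →ₗ[A] Piece F (i + j) :=
  Submodule.liftQ _
    (LinearMap.flip (Submodule.liftQ _ (LinearMap.flip (preMul F i j)) (by
      intro y hy
      refine LinearMap.ext fun x => ?_
      refine toPiece_eq_zero.2 ?_
      exact hF.mul_mem (n := j + 1) x.2 hy)))
    (by
      intro x hx
      refine LinearMap.ext fun y => ?_
      obtain ⟨y, rfl⟩ := Submodule.mkQ_surjective _ y
      refine toPiece_eq_zero.2 ?_
      have := hF.mul_mem (m := i + 1) (n := j) hx y.2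
      rwa [Nat.add_right_comm] at this)

theorem pieceMul_toPiece (i j : ℕ) (x : F i) (y : F j) :
    pieceMul F i j (toPiece F i x) (toPiece F j y) =
      toPiece F (i + j) ⟨x * y, hF.mul_mem x.2 y.2⟩ := rfl

instance : GradedMonoid.GOne (Piece F) := ⟨toPiece F 0 ⟨1, hF.one_mem⟩⟩

instance : GradedMonoid.GMul (Piece F) := ⟨fun {i j} x y => pieceMul F i j x y⟩

instance : DirectSum.GCommRing (Piece F) where
  mul_zero x := map_zero _
  zero_mul x := LinearMap.map_zero₂ (pieceMul F _ _) x
  mul_add x y z := map_add _ _ _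
  add_mul x y z := LinearMap.map_add₂ (pieceMul F _ _) x y z
  one_mul := by
    rintro ⟨i, x⟩
    obtain ⟨x, rfl⟩ := toPiece_surjective F i x
    exact gradedMonoid_mk_eq F (zero_add i) (one_mul _)
  mul_one := by
    rintro ⟨i, x⟩
    obtain ⟨x, rfl⟩ := toPiece_surjective F i x
    exact gradedMonoid_mk_eq F (add_zero i) (mul_one _)
  mul_assoc := by
    rintro ⟨i, x⟩ ⟨j, y⟩ ⟨l, z⟩
    obtain ⟨x, rfl⟩ := toPiece_surjective F i x
    obtain ⟨y, rfl⟩ := toPiece_surjective F j y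
    obtain ⟨z, rfl⟩ := toPiece_surjective F l z
    exact gradedMonoid_mk_eq F (add_assoc i j l) (mul_assoc _ _ _)
  mul_comm := by
    rintro ⟨i, x⟩ ⟨j, y⟩
    obtain ⟨x, rfl⟩ := toPiece_surjective F i x
    obtain ⟨y, rfl⟩ := toPiece_surjective F j y
    exact gradedMonoid_mk_eq F (add_comm i j) (mul_comm _ _)
  natCast n := n • toPiece F 0 ⟨1, hF.one_mem⟩
  natCast_zero := zero_nsmul _
  natCast_succ n := succ_nsmul _ n
  intCast n := n • toPiece F 0 ⟨1, hF.one_mem⟩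
  intCast_ofNat n := natCast_zsmul _ n
  intCast_negSucc_ofNat n := negSucc_zsmul _ n

instance : DirectSum.GAlgebra A (Piece F) where
  toFun := (LinearMap.toSpanSingleton A _ (toPiece F 0 ⟨1, hF.one_mem⟩)).toAddMonoidHom
  map_one := LinearMap.toSpanSingleton_apply_one A _ _
  map_mul r s := gradedMonoid_mk_eq F (x := (r * s) • ⟨1, hF.one_mem⟩)
    (y := ⟨(r • (1 : P)) * (s • (1 : P)), _⟩) (zero_add 0).symm (by
      change (r * s) • (1 : P) = (r • (1 : P)) * (s • (1 : P))
      rw [smul_mul_smul_comm, one_mul])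
  commutes := by
    rintro r ⟨i, x⟩
    obtain ⟨x, rfl⟩ := toPiece_surjective F i x
    refine gradedMonoid_mk_eq F (x := ⟨(r • (1 : P)) * x, _⟩) (y := ⟨x * (r • (1 : P)), _⟩)
      (add_comm 0 i) (mul_comm _ _)
  smul_def := by
    rintro r ⟨i, x⟩
    obtain ⟨x, rfl⟩ := toPiece_surjective F i x
    refine gradedMonoid_mk_eq F (x := r • x) (y := ⟨(r • (1 : P)) * x, _⟩) (zero_add i).symm ?_
    change r • (x : P) = (r • (1 : P)) * x
    rw [smul_mul_assoc, one_mul]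

end

end AssocGraded

/-- The associated graded algebra `⨁ F n / F (n + 1)` of a descending filtration. -/
abbrev AssocGraded {A P : Type*} [CommRing A] [CommRing P] [Algebra A P]
    (F : ℕ → Submodule A P) : Type _ := ⨁ n, AssocGraded.Piece F n

namespace AssocGraded

section

variable {A P : Type*} [CommRing A] [CommRing P] [Algebra A P] (F : ℕ → Submodule A P)

/-- The class in `F n / F (n + 1) ⊆ AssocGraded F` of an element of `F n`. -/
def cls (n : ℕ) : F n →ₗ[A] AssocGraded F :=
  DirectSum.lof A ℕ (Piece F) n ∘ₗ toPiece F n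

/-- The image of `F p ∩ Q` in `F p / F (p + 1) ⊆ AssocGraded F`. -/
def component (Q : Submodule A P) (p : ℕ) : Submodule A (AssocGraded F) :=
  (Q.comap (F p).subtype).map (cls F p)

variable {F} {A' P' : Type*} [CommRing A'] [CommRing P'] [Algebra A' P']
  {F' : ℕ → Submodule A' P'}

/-- The map of associated graded groups that is induced by a filtered additive map. -/
def map (f : P →+ P') (hf : ∀ n, ∀ x ∈ F n, f x ∈ F' n) : AssocGraded F →+ AssocGraded F' :=
  DirectSum.map fun n =>
    QuotientAddGroup.map _ ((F' (n + 1)).comap (F' n).subtype).toAddSubgroup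
      { toFun := fun x : F n => (⟨f x, hf n x x.2⟩ : F' n)
        map_zero' := Subtype.ext (map_zero f)
        map_add' := fun _ _ => Subtype.ext (map_add f _ _) }
      (fun x hx => hf (n + 1) x hx)

theorem map_cls (f : P →+ P') (hf : ∀ n, ∀ x ∈ F n, f x ∈ F' n) (n : ℕ) (x : F n) :
    map f hf (cls F n x) = cls F' n ⟨f x, hf n x x.2⟩ :=
  DirectSum.map_of _ _ _

end

end AssocGraded

/-! ### The Poisson envelope of a commutative algebra -/

namespace SymmetricAlgebra

theorem mapSemilinear_lieBracket {k 𝔤 𝔥 : Type*} [CommRing k] [LieRing 𝔤] [LieAlgebra k 𝔤]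
    [LieRing 𝔥] [LieAlgebra k 𝔥] (g : 𝔤 →ₗ[k] 𝔥) (hg : ∀ x y, g ⁅x, y⁆ = ⁅g x, g y⁆)
    (a b : SymmetricAlgebra k 𝔤) :
    mapSemilinear g (lieBracket a b) = lieBracket (mapSemilinear g a) (mapSemilinear g b) := by
  induction a using SymmetricAlgebra.induction with
  | algebraMap r => simp [lieBracket_algebraMap_left, mapSemilinear_algebraMap]
  | ι x =>
    induction b using SymmetricAlgebra.induction with
    | algebraMap r => simp [lieBracket_algebraMap_right, mapSemilinear_algebraMap]
    | ι y => simp only [lieBracket_ι, mapSemilinear_ι, hg]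
    | mul b c hb hc => simp only [lieBracket_mul_right, map_add, map_mul, hb, hc]
    | add b c hb hc => simp only [map_add, hb, hc]
  | mul a c ha hc => simp only [lieBracket_mul_left, map_add, map_mul, ha, hc]
  | add a c ha hc => simp only [map_add, LinearMap.add_apply, ha, hc]

end SymmetricAlgebra

/-- The free Poisson algebra `S L V` on a `k`-module `V`. -/
abbrev FreePoisson (k V : Type*) [CommRing k] [AddCommGroup V] [Module k V] : Type _ :=
  SymmetricAlgebra k (FreeLie k V)

namespace FreePoisson

variable (k V : Type*) [CommRing k] [AddCommGroup V] [Module k V]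

/-- The inclusion `S V → S L V`. -/
def ofSym : SymmetricAlgebra k V →ₐ[k] FreePoisson k V :=
  SymmetricAlgebra.lift (SymmetricAlgebra.ι k (FreeLie k V) ∘ₗ FreeLie.ι k V)

/-- The span of the products of elements of the components `L_d` of `L V` that have exactly `p`
factors of positive degree and total degree `q`. -/
def bideg (p q : ℕ) : Submodule k (FreePoisson k V) :=
  SymmetricAlgebra.bideg (FreeLie.deg k V) (fun d => if d = 0 then 0 else 1) p q

/-- The elements of degree `q`, for the grading induced by that of `L V`. -/
def deg (q : ℕ) : Submodule k (FreePoisson k V) := ⨆ p, bideg k V p q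

/-- The sum of the components with at least `n` factors in `L_+ V`. -/
def filt (n : ℕ) : Submodule k (FreePoisson k V) := ⨆ p, ⨆ (_ : n ≤ p), ⨆ q, bideg k V p q

variable {k V}

theorem ofSym_ι (v : V) :
    ofSym k V (SymmetricAlgebra.ι k V v) = SymmetricAlgebra.ι k _ (FreeLie.ι k V v) :=
  SymmetricAlgebra.lift_ι_apply _ v

theorem bideg_le_filt {n p : ℕ} (h : n ≤ p) (q : ℕ) : bideg k V p q ≤ filt k V n :=
  le_iSup_of_le p (le_iSup_of_le h (le_iSup_of_le q le_rfl))

theorem filt_le {n : ℕ} {W : Submodule k (FreePoisson k V)}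
    (h : ∀ p q, n ≤ p → bideg k V p q ≤ W) : filt k V n ≤ W :=
  iSup_le fun p => iSup_le fun hp => iSup_le fun q => h p q hp

theorem filt_mul {m n : ℕ} {x y : FreePoisson k V} (hx : x ∈ filt k V m) (hy : y ∈ filt k V n) :
    x * y ∈ filt k V (m + n) := by
  have h : filt k V m ≤ (filt k V (m + n)).comap (LinearMap.mulRight k y) := by
    refine filt_le fun p q hp x hx => ?_
    have h' : filt k V n ≤ (filt k V (m + n)).comap (LinearMap.mulLeft k x) :=
      filt_le fun p' q' hp' z hz =>
        bideg_le_filt (add_le_add hp hp') (q + q') (SymmetricAlgebra.bideg_mul hx hz)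
    exact h' hy
  exact h hx

theorem ι_mem_bideg_zero (v : V) :
    SymmetricAlgebra.ι k _ (FreeLie.ι k V v) ∈ bideg k V 0 0 := by
  rw [bideg]
  exact SymmetricAlgebra.ι_mem_bideg (d := 0) (by simp) (FreeLie.ι_mem_deg k V v)

theorem ι_mul_mem_filt (v : V) {n : ℕ} {x : FreePoisson k V} (hx : x ∈ filt k V n) :
    SymmetricAlgebra.ι k _ (FreeLie.ι k V v) * x ∈ filt k V n := by
  have := filt_mul (bideg_le_filt le_rfl 0 (ι_mem_bideg_zero v)) hx
  rwa [zero_add] at this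

theorem ι_mul_mem_deg (v : V) {q : ℕ} {x : FreePoisson k V} (hx : x ∈ deg k V q) :
    SymmetricAlgebra.ι k _ (FreeLie.ι k V v) * x ∈ deg k V q := by
  have h : deg k V q ≤ (deg k V q).comap
      (LinearMap.mulLeft k (SymmetricAlgebra.ι k _ (FreeLie.ι k V v))) := by
    refine iSup_le fun p x hx => ?_
    have := SymmetricAlgebra.bideg_mul (ι_mem_bideg_zero v) hx
    rw [zero_add, zero_add] at this
    exact Submodule.mem_iSup_of_mem p this
  exact h hx

/-- The map of free Poisson algebras induced by a linear map. -/
def map {W : Type*} [AddCommGroup W] [Module k W] (g : V →ₗ[k] W) :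
    FreePoisson k V →+* FreePoisson k W :=
  SymmetricAlgebra.mapSemilinear (FreeLie.map g)

theorem map_ofSym {W : Type*} [AddCommGroup W] [Module k W] (g : V →ₗ[k] W)
    (x : SymmetricAlgebra k V) :
    map g (ofSym k V x) = ofSym k W (SymmetricAlgebra.mapSemilinear g x) := by
  induction x using SymmetricAlgebra.induction with
  | algebraMap r => simp [map, SymmetricAlgebra.mapSemilinear_algebraMap]
  | ι a => simp only [map, ofSym_ι, SymmetricAlgebra.mapSemilinear_ι, FreeLie.map_ι]
  | mul a b ha hb => simp only [map_mul, ha, hb]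
  | add a b ha hb => simp only [map_add, ha, hb]

theorem map_mem_filt {W : Type*} [AddCommGroup W] [Module k W] (g : V →ₗ[k] W) {n : ℕ}
    {x : FreePoisson k V} (hx : x ∈ filt k V n) : map g x ∈ filt k W n := by
  let g' : FreePoisson k V →ₗ[k] FreePoisson k W :=
    { map g with
      map_smul' := fun r x => by
        change map g (r • x) = r • map g x
        rw [Algebra.smul_def, Algebra.smul_def, map_mul]
        congr 1
        exact SymmetricAlgebra.mapSemilinear_algebraMap _ r }
  have h : filt k V n ≤ (filt k W n).comap g' := filt_le fun p q hp x hx =>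
    bideg_le_filt hp q
      (SymmetricAlgebra.mapSemilinear_mem_bideg _ (fun _ _ hm => FreeLie.map_mem_deg g _ hm) _ hx)
  exact h hx

end FreePoisson

namespace PoissonEnvelope

variable (k A : Type*) [CommRing k] [CommRing A] [Algebra k A]

/-- The kernel `I A` of the canonical projection `S A → A`. -/
def symKer : Ideal (SymmetricAlgebra k A) :=
  RingHom.ker (SymmetricAlgebra.lift (LinearMap.id : A →ₗ[k] A))

/-- The Poisson ideal of `S L A` generated by `I A`. -/
def ideal : Ideal (FreePoisson k A) :=
  PoissonAlgebra.poissonSpan k (FreePoisson.ofSym k A '' symKer k A)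

end PoissonEnvelope

/-- The Poisson envelope `P A = S L A / ⟨⟨I A⟩⟩` of a commutative `k`-algebra `A`. -/
def PoissonEnvelope (k A : Type*) [CommRing k] [CommRing A] [Algebra k A] : Type _ :=
  FreePoisson k A ⧸ PoissonEnvelope.ideal k A

namespace PoissonEnvelope

section

variable (k A : Type*) [CommRing k] [CommRing A] [Algebra k A]

instance : CommRing (PoissonEnvelope k A) :=
  inferInstanceAs (CommRing (FreePoisson k A ⧸ ideal k A))

instance : Algebra k (PoissonEnvelope k A) :=
  inferInstanceAs (Algebra k (FreePoisson k A ⧸ ideal k A))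

instance : PoissonAlgebra k (PoissonEnvelope k A) :=
  PoissonAlgebra.quotient k (PoissonAlgebra.isPoissonIdeal_poissonSpan k _)

/-- The projection `S L A → P A`. -/
def proj : FreePoisson k A →ₐ[k] PoissonEnvelope k A := Ideal.Quotient.mkₐ k (ideal k A)

variable {k A} in
theorem proj_eq_zero {x : FreePoisson k A} : proj k A x = 0 ↔ x ∈ ideal k A :=
  Ideal.Quotient.eq_zero_iff_mem

variable {k A} in
theorem proj_ofSym_eq_zero {x : SymmetricAlgebra k A}
    (hx : SymmetricAlgebra.lift (LinearMap.id : A →ₗ[k] A) x = 0) :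
    proj k A (FreePoisson.ofSym k A x) = 0 :=
  proj_eq_zero.2 (PoissonAlgebra.subset_poissonSpan k _ ⟨x, hx, rfl⟩)

/-- The canonical homomorphism `A → P A`. -/
def of : A →ₐ[k] PoissonEnvelope k A :=
  AlgHom.ofLinearMap
    ((proj k A).toLinearMap ∘ₗ SymmetricAlgebra.ι k _ ∘ₗ FreeLie.ι k A)
    (by
      have h := proj_ofSym_eq_zero (k := k) (A := A) (x := SymmetricAlgebra.ι k A 1 - 1)
        (by simp)
      rw [map_sub, map_sub, map_one (FreePoisson.ofSym k A), map_one (proj k A), sub_eq_zero,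
        FreePoisson.ofSym_ι] at h
      exact h)
    (fun a b => by
      have h := proj_ofSym_eq_zero (k := k) (A := A)
        (x := SymmetricAlgebra.ι k A (a * b) - SymmetricAlgebra.ι k A a * SymmetricAlgebra.ι k A b)
        (by simp)
      rw [map_sub, map_sub, map_mul (FreePoisson.ofSym k A), map_mul (proj k A), sub_eq_zero,
        FreePoisson.ofSym_ι, FreePoisson.ofSym_ι, FreePoisson.ofSym_ι] at h
      exact h)

instance : Algebra A (PoissonEnvelope k A) := (of k A).toRingHom.toAlgebra

variable {k A} in
theorem smul_proj (a : A) (x : FreePoisson k A) :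
    a • proj k A x = proj k A (SymmetricAlgebra.ι k _ (FreeLie.ι k A a) * x) := by
  rw [Algebra.smul_def, map_mul]
  rfl

/-- The component `P_q A`, the image of the elements of degree `q`. -/
def deg (q : ℕ) : Submodule A (PoissonEnvelope k A) where
  carrier := proj k A '' FreePoisson.deg k A q
  add_mem' := by
    rintro _ _ ⟨x, hx, rfl⟩ ⟨y, hy, rfl⟩
    exact ⟨x + y, add_mem hx hy, map_add _ _ _⟩
  zero_mem' := ⟨0, zero_mem _, map_zero _⟩
  smul_mem' := by
    rintro a _ ⟨x, hx, rfl⟩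
    exact ⟨_, FreePoisson.ι_mul_mem_deg a hx, (smul_proj a x).symm⟩

/-- The filtration `H^n`: the image of the elements with at least `n` factors in `L_+ A`. -/
def filt (n : ℕ) : Submodule A (PoissonEnvelope k A) where
  carrier := proj k A '' FreePoisson.filt k A n
  add_mem' := by
    rintro _ _ ⟨x, hx, rfl⟩ ⟨y, hy, rfl⟩
    exact ⟨x + y, add_mem hx hy, map_add _ _ _⟩
  zero_mem' := ⟨0, zero_mem _, map_zero _⟩
  smul_mem' := by
    rintro a _ ⟨x, hx, rfl⟩
    exact ⟨_, FreePoisson.ι_mul_mem_filt a hx, (smul_proj a x).symm⟩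

instance : IsDescendingFiltration (filt k A) where
  succ_le n := Set.image_mono
    (FreePoisson.filt_le fun _ q hp => FreePoisson.bideg_le_filt ((Nat.le_succ n).trans hp) q)
  one_mem := ⟨1, FreePoisson.bideg_le_filt le_rfl 0 (SymmetricAlgebra.one_mem_bideg _ _),
    map_one _⟩
  mul_mem := by
    rintro m n _ _ ⟨x, hx, rfl⟩ ⟨y, hy, rfl⟩
    exact ⟨x * y, FreePoisson.filt_mul hx hy, map_mul _ _ _⟩

end

section nested

variable {k A : Type*} [CommRing k] [CommRing A] [Algebra k A]

variable (k) in
/-- The right-nested Poisson bracket `{a₀, {a₁, {…, aₙ}…}}` in `P A` of the entries of a nonempty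
list of elements of `A`. -/
def nested : A → List A → PoissonEnvelope k A
  | a, [] => of k A a
  | a, b :: l => PoissonAlgebra.bracket (k := k) (of k A a) (nested b l)

theorem nested_eq (a : A) (l : List A) :
    nested k a l = proj k A (SymmetricAlgebra.ι k _ (FreeLie.nested (id : A → A) a l)) := by
  induction l generalizing a with
  | nil => rfl
  | cons b l ih =>
    rw [nested, ih, FreeLie.nested, ← SymmetricAlgebra.lieBracket_ι]
    rfl

theorem nested_mem_filt (a b : A) (l : List A) : nested k a (b :: l) ∈ filt k A 1 := by
  rw [nested_eq]
  refine ⟨_, FreePoisson.bideg_le_filt le_rfl (l.length + 1) ?_, rfl⟩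
  rw [FreePoisson.bideg]
  exact SymmetricAlgebra.ι_mem_bideg (d := l.length + 1) (by simp)
    (FreeLie.nested_mem_deg (R := k) (id : A → A) a (b :: l))

end nested

section map

variable {k A B : Type*} [CommRing k] [CommRing A] [Algebra k A] [CommRing B] [Algebra k B]

theorem lift_id_mapSemilinear (f : A →ₐ[k] B) (x : SymmetricAlgebra k A) :
    SymmetricAlgebra.lift (LinearMap.id : B →ₗ[k] B)
      (SymmetricAlgebra.mapSemilinear f.toLinearMap x) =
    f (SymmetricAlgebra.lift (LinearMap.id : A →ₗ[k] A) x) := by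
  induction x using SymmetricAlgebra.induction with
  | algebraMap r => simp [SymmetricAlgebra.mapSemilinear_algebraMap]
  | ι a => simp [SymmetricAlgebra.mapSemilinear_ι]
  | mul a b ha hb => simp only [map_mul, ha, hb]
  | add a b ha hb => simp only [map_add, ha, hb]

/-- Functoriality of the Poisson envelope. -/
def map (f : A →ₐ[k] B) : PoissonEnvelope k A →+* PoissonEnvelope k B :=
  Ideal.quotientMap (ideal k B) (FreePoisson.map f.toLinearMap) (by
    refine PoissonAlgebra.poissonSpan_le k (fun a x hx => ?_) ?_
    · have h := PoissonAlgebra.isPoissonIdeal_poissonSpan k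
        (FreePoisson.ofSym k B '' symKer k B) (FreePoisson.map f.toLinearMap a) _ hx
      have e : FreePoisson.map f.toLinearMap (PoissonAlgebra.bracket (k := k) a x) =
          PoissonAlgebra.bracket (k := k) (FreePoisson.map f.toLinearMap a)
            (FreePoisson.map f.toLinearMap x) :=
        SymmetricAlgebra.mapSemilinear_lieBracket _ (FreeLie.map_lie _) a x
      rw [Ideal.mem_comap, e]
      exact h
    · rintro _ ⟨x, hx, rfl⟩
      refine PoissonAlgebra.subset_poissonSpan k _
        ⟨SymmetricAlgebra.mapSemilinear f.toLinearMap x, ?_, ?_⟩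
      · change SymmetricAlgebra.lift (LinearMap.id : B →ₗ[k] B) _ = 0
        rw [lift_id_mapSemilinear, show SymmetricAlgebra.lift (LinearMap.id : A →ₗ[k] A) x = 0
          from hx, map_zero]
      · exact (FreePoisson.map_ofSym _ x).symm)

theorem map_proj (f : A →ₐ[k] B) (x : FreePoisson k A) :
    map f (proj k A x) = proj k B (FreePoisson.map f.toLinearMap x) := rfl

theorem map_mem_filt (f : A →ₐ[k] B) (n : ℕ) (x : PoissonEnvelope k A) (hx : x ∈ filt k A n) :
    map f x ∈ filt k B n := by
  obtain ⟨y, hy, rfl⟩ := hx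
  exact ⟨_, FreePoisson.map_mem_filt _ hy, (map_proj f y).symm⟩

end map

end PoissonEnvelope

/-! ### The two bigraded algebras -/

section bigraded

variable (k A : Type*) [CommRing k] [CommRing A] [Algebra k A]

/-- The associated graded algebra `G P A` of `P A` for the filtration `H`. -/
abbrev GrPoissonEnvelope : Type _ := AssocGraded (PoissonEnvelope.filt k A)

/-- The component `G^p_q P A`: the image of `H^p ∩ P_q A` in `H^p / H^(p+1)`. -/
def GrPoissonEnvelope.bideg (p q : ℕ) : Submodule A (GrPoissonEnvelope k A) :=
  AssocGraded.component (PoissonEnvelope.filt k A) (PoissonEnvelope.deg k A q) p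

/-- Functoriality of `G P A`. -/
def GrPoissonEnvelope.map {k A B : Type*} [CommRing k] [CommRing A] [Algebra k A] [CommRing B]
    [Algebra k B] (f : A →ₐ[k] B) : GrPoissonEnvelope k A →+ GrPoissonEnvelope k B :=
  AssocGraded.map (PoissonEnvelope.map f).toAddMonoidHom (PoissonEnvelope.map_mem_filt f)

/-- The symmetric `A`-algebra of `L_+^A Ω_A`. -/
abbrev SymLieKaehler : Type _ := SymmetricAlgebra A (FreeLie.plus A Ω[A⁄k])

/-- The component of symmetric power degree `p` whose degree for the grading induced by that of
the free Lie algebra is `q`. -/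
def SymLieKaehler.bideg (p q : ℕ) : Submodule A (SymLieKaehler k A) :=
  SymmetricAlgebra.bideg (FreeLie.plusDeg A Ω[A⁄k]) (fun _ => 1) p q

/-- The semilinear map `Ω_A → Ω_B`, `da ↦ d(f a)`, induced by a homomorphism `f : A → B`. -/
def kaehlerMap {k A B : Type*} [CommRing k] [CommRing A] [Algebra k A] [CommRing B]
    [Algebra k B] (f : A →ₐ[k] B) : Ω[A⁄k] →ₛₗ[f.toRingHom] Ω[B⁄k] :=
  letI : Algebra A B := f.toRingHom.toAlgebra
  haveI : IsScalarTower k A B := IsScalarTower.of_algebraMap_eq fun r => (f.commutes r).symm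
  { toFun := KaehlerDifferential.map k k A B
    map_add' := map_add _
    map_smul' := fun a x => by
      rw [map_smul, ← algebraMap_smul B a]
      rfl }

theorem kaehlerMap_D {k A B : Type*} [CommRing k] [CommRing A] [Algebra k A] [CommRing B]
    [Algebra k B] (f : A →ₐ[k] B) (a : A) :
    kaehlerMap f (KaehlerDifferential.D k A a) = KaehlerDifferential.D k B (f a) := by
  let _ : Algebra A B := f.toRingHom.toAlgebra
  have _ : IsScalarTower k A B := IsScalarTower.of_algebraMap_eq fun r => (f.commutes r).symm
  exact KaehlerDifferential.map_D k k A B a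

/-- Functoriality of `S^A L_+^A Ω_A`. -/
def SymLieKaehler.map {k A B : Type*} [CommRing k] [CommRing A] [Algebra k A] [CommRing B]
    [Algebra k B] (f : A →ₐ[k] B) : SymLieKaehler k A →+* SymLieKaehler k B :=
  SymmetricAlgebra.mapSemilinear (FreeLie.plusMap (kaehlerMap f))

end bigraded

end

open scoped TensorProduct

/-! ### Gradings from projections -/

/-! The map. The augmentation `ε : P A → A` kills all brackets, so the fibre of the differentials of
`P A` along `ε` is an `A`-Lie algebra with `[df, dg] = d{f, g}` (`Cotangent`). It receives `Ω_A`
through `A → P A`, hence the whole free `A`-Lie algebra on `Ω_A`. It maps to `H^1 / H^2` by `df ↦ f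
- ε(f)`, since this is a derivation modulo `H^2`. Restriction to `L_+` and multiplicative extension
give `comparison`. The detour through the fibre is needed because the generators `da` go to `0` in
`H^1 / H^2`, although their brackets need not.

Surjectivity, bidegrees, naturality and the bracket formula. There is a ring homomorphism
`ofFreePoisson` from `S L A` to the symmetric algebra on `L_+` of `Ω_A`; it sends `a` to `a` and an
iterated bracket of elements `aᵢ` to that of the `daᵢ`. Every element of bidegree `(p, q)` is the
image of an element of the same bidegree, since differentials span `Ω_A` over `A`
(`exists_ofFreePoisson_eq`). On elements of bidegree `(p, q)`, the composite with `comparison` is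
the passage to the class in `H^p / H^(p+1)` (`comparison_ofFreePoisson`).

Injectivity. Let `J` be the augmentation ideal of the symmetric algebra on `L_+`, and let `x`, of
bidegree `(p, q)`, be killed. Lift `x` to `z` of the same bidegree; then `z = y + u` with `y` having
more than `p` factors in `L_+ A` and `u` in the Poisson ideal generated by `I A`. Formal smoothness
gives a linear section `s : A → S A` whose multiplicative extension sends `I A` into its power `p +
1` (`exists_section_symKer_pow`). The Poisson endomorphism `endo s` of `S L A` then sends `u` into
the power `p + 1` of the augmentation ideal (`endo_mem_augIdeal_pow`). A first-order Taylor
expansion shows that `endo s` does not alter leading terms: it changes the image of an element with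
`p` positive factors only by `J ^ (p + 1)` (`ofFreePoisson_endo_sub_mem`). So `x` lies in `J ^ (p +
1)`, and being homogeneous of symmetric degree `p` it is zero.

The bigradings come from explicit projections; on `P A` they exist because the Poisson ideal is
generated in degree `0` and is therefore homogeneous (`ideal_isHomogeneous`). -/

theorem iSupIndep_of_projections {R M ι : Type*} [Ring R] [AddCommGroup M] [Module R M]
    (N : ι → Submodule R M) (π : ι → M →ₗ[R] M) (h : ∀ i, ∀ x ∈ N i, π i x = x)
    (h' : ∀ i j, i ≠ j → ∀ x ∈ N j, π i x = 0) : iSupIndep N := by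
  intro i
  rw [Submodule.disjoint_def]
  intro x hx hx'
  have hle : (⨆ j, ⨆ (_ : j ≠ i), N j) ≤ LinearMap.ker (π i) :=
    iSup_le fun j => iSup_le fun hj y hy => h' i j hj.symm y hy
  rw [← h i x hx]
  exact hle hx'

/-! ### The grading of the free Lie algebra -/

namespace FreeLie

section grading

variable {R M : Type*} [CommRing R] [AddCommGroup M] [Module R M]

/-- The preimage of the motive in the free Lie algebra on a set is a Lie subalgebra containing the
generators; the map into it given by the universal property splits its inclusion. The zero case is
obtained as `0 • ι 0`. -/
theorem induction {motive : FreeLie R M → Prop} (ι : ∀ m, motive (ι R M m))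
    (add : ∀ x y, motive x → motive y → motive (x + y))
    (smul : ∀ (r : R) x, motive x → motive (r • x))
    (lie : ∀ x y, motive x → motive y → motive ⁅x, y⁆) (x : FreeLie R M) : motive x := by
  obtain ⟨y, rfl⟩ := mk_surjective R M x
  let K : LieSubalgebra R (FreeLieAlgebra R M) :=
    { carrier := {y | motive (mk R M y)}
      add_mem' := fun {a b} ha hb => by
        have := add _ _ ha hb
        rwa [← map_add] at this
      zero_mem' := by
        have := smul 0 _ (ι 0)
        rw [zero_smul] at this
        rwa [Set.mem_ofPred_eq, map_zero]
      smul_mem' := fun r a ha => by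
        have := smul r _ ha
        rwa [← map_smul] at this
      lie_mem' := fun {a b} ha hb => by
        have := lie _ _ ha hb
        rwa [← LieHom.map_lie] at this }
  let F : FreeLieAlgebra R M →ₗ⁅R⁆ K := FreeLieAlgebra.lift R fun m => ⟨FreeLieAlgebra.of R m, ι m⟩
  have hF : K.incl.comp F = LieHom.id := by
    ext m
    simp [F]
  have := (F y).2
  rwa [show ((F y : K) : FreeLieAlgebra R M) = y from DFunLike.congr_fun hF y] at this

/-- Induction on the left degree with the Jacobi identity `[[m, z], y] = [m, [z, y]] - [z, [m, y]]`.
Degree `n` means `n + 1` letters, whence the extra `1`. -/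
theorem lie_mem_deg {i j : ℕ} {x y : FreeLie R M} (hx : x ∈ deg R M i) (hy : y ∈ deg R M j) :
    ⁅x, y⁆ ∈ deg R M (i + j + 1) := by
  induction i generalizing j x y with
  | zero =>
    obtain ⟨m, rfl⟩ := hx
    rw [zero_add]
    exact Submodule.subset_span ⟨m, y, hy, rfl⟩
  | succ i ih =>
    rw [deg_succ] at hx
    induction hx using Submodule.span_induction with
    | mem x hx =>
      obtain ⟨m, z, hz, rfl⟩ := hx
      rw [lie_lie]
      have h1 : ⁅ι R M m, ⁅z, y⁆⁆ ∈ deg R M (i + 1 + j + 1) := by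
        rw [Nat.add_right_comm i 1 j]
        exact Submodule.subset_span ⟨m, _, ih hz hy, rfl⟩
      have h2 : ⁅z, ⁅ι R M m, y⁆⁆ ∈ deg R M (i + 1 + j + 1) := by
        have hmy : ⁅ι R M m, y⁆ ∈ deg R M (j + 1) := Submodule.subset_span ⟨m, y, hy, rfl⟩
        have := ih hz hmy
        rwa [← add_assoc, Nat.add_right_comm i j 1] at this
      exact sub_mem h1 h2
    | zero => rw [zero_lie]; exact zero_mem _
    | add x x' _ _ h h' => rw [add_lie]; exact add_mem h h'
    | smul r x _ h => rw [smul_lie]; exact Submodule.smul_mem _ r h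

theorem iSup_deg : ⨆ n, deg R M n = ⊤ := by
  rw [eq_top_iff]
  rintro x -
  induction x using induction with
  | ι m => exact Submodule.mem_iSup_of_mem 0 (ι_mem_deg R M m)
  | add x y hx hy => exact add_mem hx hy
  | smul r x hx => exact Submodule.smul_mem _ r hx
  | lie x y hx hy =>
    induction hx using Submodule.iSup_induction' with
    | zero => rw [zero_lie]; exact zero_mem _
    | add x x' _ _ h h' => rw [add_lie]; exact add_mem h h'
    | mem i x hx =>
      induction hy using Submodule.iSup_induction' with
      | zero => rw [lie_zero]; exact zero_mem _
      | add x x' _ _ h h' => rw [lie_add]; exact add_mem h h'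
      | mem j y hy => exact Submodule.mem_iSup_of_mem _ (lie_mem_deg hx hy)

open TensorProduct Polynomial

variable (R M) in
/-- The coaction `x ↦ tⁿ⁺¹ ⊗ x`, for `x` of degree `n`, that encodes the grading. -/
noncomputable def coaction : FreeLie R M →ₗ⁅R⁆ R[X] ⊗[R] FreeLie R M :=
  lift (TensorProduct.mk R R[X] (FreeLie R M) X ∘ₗ ι R M)

/-- The bracket of `R[X] ⊗ L` multiplies polynomials, so the exponent must be additive under
brackets: it is the number of letters `n + 1`, not the degree `n`. -/
theorem coaction_of_mem {n : ℕ} {x : FreeLie R M} (hx : x ∈ deg R M n) :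
    coaction R M x = (X ^ (n + 1) : R[X]) ⊗ₜ[R] x := by
  induction n generalizing x with
  | zero =>
    obtain ⟨m, rfl⟩ := hx
    rw [coaction, lift_ι]
    simp
  | succ n ih =>
    rw [deg_succ] at hx
    induction hx using Submodule.span_induction with
    | mem x hx =>
      obtain ⟨m, z, hz, rfl⟩ := hx
      rw [LieHom.map_lie, ih hz, coaction, lift_ι]
      simp only [LinearMap.comp_apply, TensorProduct.mk_apply,
        LieAlgebra.ExtendScalars.bracket_tmul]
      rw [pow_succ' X (n + 1)]
    | zero => simp
    | add x x' _ _ h h' => rw [map_add, h, h', TensorProduct.tmul_add]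
    | smul r x _ h => rw [map_smul, h, TensorProduct.tmul_smul]

variable (R M) in
/-- The projection of the free Lie algebra onto its component of degree `n`. -/
noncomputable def degProj (n : ℕ) : FreeLie R M →ₗ[R] FreeLie R M :=
  TensorProduct.lift (LinearMap.lsmul R (FreeLie R M) ∘ₗ lcoeff R (n + 1)) ∘ₗ
    (coaction R M : FreeLie R M →ₗ[R] R[X] ⊗[R] FreeLie R M)

theorem degProj_of_mem {n : ℕ} {x : FreeLie R M} (hx : x ∈ deg R M n) : degProj R M n x = x := by
  have := coaction_of_mem hx
  simp [degProj, this]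

theorem degProj_of_mem_ne {n m : ℕ} (h : n ≠ m) {x : FreeLie R M} (hx : x ∈ deg R M m) :
    degProj R M n x = 0 := by
  have := coaction_of_mem hx
  simp [degProj, this, coeff_X_pow, h]

theorem iSupIndep_deg : iSupIndep (deg R M) :=
  iSupIndep_of_projections _ (degProj R M) (fun _ _ hx => degProj_of_mem hx)
    (fun _ _ h _ hx => degProj_of_mem_ne h hx)

theorem degProj_mem (n : ℕ) (x : FreeLie R M) : degProj R M n x ∈ deg R M n := by
  have hx : x ∈ ⨆ n, deg R M n := by rw [iSup_deg]; trivial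
  induction hx using Submodule.iSup_induction' with
  | zero => simp
  | add x y _ _ hx hy => rw [map_add]; exact add_mem hx hy
  | mem m x hx =>
    obtain rfl | h := eq_or_ne n m
    · rwa [degProj_of_mem hx]
    · rw [degProj_of_mem_ne h hx]; exact zero_mem _

theorem deg_succ_le_plus (n : ℕ) : deg R M (n + 1) ≤ plus R M :=
  le_iSup (fun n => deg R M (n + 1)) n

theorem degProj_zero_of_mem_plus {x : FreeLie R M} (hx : x ∈ plus R M) : degProj R M 0 x = 0 := by
  have : plus R M ≤ LinearMap.ker (degProj R M 0) :=
    iSup_le fun n y hy => degProj_of_mem_ne (Nat.succ_ne_zero n).symm hy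
  exact this hx

theorem sub_degProj_zero_mem_plus (x : FreeLie R M) : x - degProj R M 0 x ∈ plus R M := by
  have hx : x ∈ ⨆ n, deg R M n := by rw [iSup_deg]; trivial
  induction hx using Submodule.iSup_induction' with
  | zero => simp
  | add x y _ _ hx hy => rw [map_add, add_sub_add_comm]; exact add_mem hx hy
  | mem m x hx =>
    obtain _ | m := m
    · rw [degProj_of_mem hx, sub_self]; exact zero_mem _
    · rw [degProj_of_mem_ne (Nat.succ_ne_zero m).symm hx, sub_zero]
      exact deg_succ_le_plus m hx

variable (R M) in
/-- The projection of the free Lie algebra onto `L_+`. -/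
noncomputable def plusProj : FreeLie R M →ₗ[R] plus R M :=
  (LinearMap.id - degProj R M 0).codRestrict _ sub_degProj_zero_mem_plus

theorem plusProj_coe (x : FreeLie R M) : (plusProj R M x : FreeLie R M) = x - degProj R M 0 x := rfl

theorem plusProj_ι (m : M) : plusProj R M (ι R M m) = 0 :=
  Subtype.ext (by rw [plusProj_coe, degProj_of_mem (ι_mem_deg R M m), sub_self]; rfl)

theorem plusProj_of_mem_plus {x : FreeLie R M} (hx : x ∈ plus R M) :
    plusProj R M x = ⟨x, hx⟩ :=
  Subtype.ext (by rw [plusProj_coe, degProj_zero_of_mem_plus hx, sub_zero])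

/-- With this, only positive degrees contribute generators to the symmetric algebra on `L_+`, where
every factor has weight `1`. -/
theorem plusDeg_zero : plusDeg R M 0 = ⊥ := by
  rw [eq_bot_iff]
  intro x hx
  have h1 := degProj_of_mem (show (x : FreeLie R M) ∈ deg R M 0 from hx)
  rw [degProj_zero_of_mem_plus x.2] at h1
  exact Subtype.ext h1.symm

variable (R M) in
noncomputable instance : DirectSum.Decomposition (deg R M) :=
  DirectSum.IsInternal.chooseDecomposition _
    (DirectSum.isInternal_submodule_of_iSupIndep_of_iSup_eq_top iSupIndep_deg iSup_deg)

theorem iSup_plusDeg : ⨆ n, plusDeg R M n = ⊤ := by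
  apply Submodule.map_injective_of_injective (plus R M).injective_subtype
  rw [Submodule.map_iSup, Submodule.map_subtype_top]
  refine le_antisymm (iSup_le fun n => Submodule.map_subtype_le _ _) ?_
  refine iSup_le fun n x hx => Submodule.mem_iSup_of_mem (n + 1) ?_
  exact ⟨⟨x, deg_succ_le_plus n hx⟩, hx, rfl⟩

theorem iSupIndep_plusDeg : iSupIndep (plusDeg R M) := by
  have h : ∀ n, ∀ x ∈ plus R M, degProj R M n x ∈ plus R M := by
    intro n x hx
    obtain _ | n := n
    · rw [degProj_zero_of_mem_plus hx]; exact zero_mem _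
    · exact deg_succ_le_plus n (degProj_mem _ x)
  exact iSupIndep_of_projections _ (fun n => (degProj R M n).restrict (h n))
    (fun _ _ hx => Subtype.ext (degProj_of_mem hx))
    (fun _ _ hn _ hx => Subtype.ext (degProj_of_mem_ne hn hx))

variable (R M) in
noncomputable instance : DirectSum.Decomposition (plusDeg R M) :=
  DirectSum.IsInternal.chooseDecomposition _
    (DirectSum.isInternal_submodule_of_iSupIndep_of_iSup_eq_top iSupIndep_plusDeg iSup_plusDeg)

end grading

end FreeLie

/-! ### Gradings of symmetric algebras -/

namespace SymmetricAlgebra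

section grading

variable {R M : Type*} [CommRing R] [AddCommGroup M] [Module R M]

/-- The span of the products `m₁ ⋯ mᵣ` with `mᵢ ∈ 𝓜 dᵢ` and `∑ g dᵢ = γ`. -/
noncomputable def gdeg {G : Type*} [AddCommMonoid G] (𝓜 : ℕ → Submodule R M) (g : ℕ → G) (γ : G) :
    Submodule R (SymmetricAlgebra R M) :=
  Submodule.span R {x | ∃ l : List (ℕ × M), (∀ z ∈ l, z.2 ∈ 𝓜 z.1) ∧
    (l.map fun z => g z.1).sum = γ ∧ x = (l.map fun z => ι R M z.2).prod}

variable {G : Type*} [AddCommMonoid G] {𝓜 : ℕ → Submodule R M} {g : ℕ → G}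

/-- Spanning products are built by one factor at a time, so a multiplicative property of homogeneous
elements has to be checked only for `1` and for multiplication by one homogeneous generator. -/
theorem gdeg_induction {motive : G → SymmetricAlgebra R M → Prop}
    (zero : ∀ γ, motive γ 0) (one : motive 0 1)
    (ι_mul : ∀ d, ∀ m ∈ 𝓜 d, ∀ γ, ∀ y ∈ gdeg 𝓜 g γ, motive γ y → motive (g d + γ) (ι R M m * y))
    (add : ∀ γ x y, motive γ x → motive γ y → motive γ (x + y))
    (smul : ∀ γ (r : R) x, motive γ x → motive γ (r • x))
    {γ : G} {x : SymmetricAlgebra R M} (hx : x ∈ gdeg 𝓜 g γ) : motive γ x := by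
  induction hx using Submodule.span_induction with
  | mem x hx =>
    obtain ⟨l, hl, rfl, rfl⟩ := hx
    induction l with
    | nil => simpa using one
    | cons z l ih =>
      rw [List.map_cons, List.map_cons, List.prod_cons, List.sum_cons]
      have hl' : ∀ y ∈ l, y.2 ∈ 𝓜 y.1 := fun y hy => hl y (List.mem_cons_of_mem _ hy)
      exact ι_mul _ _ (hl z List.mem_cons_self) _ _ (Submodule.subset_span ⟨l, hl', rfl, rfl⟩)
        (ih hl')
  | zero => exact zero γ
  | add x y _ _ hx hy => exact add γ x y hx hy
  | smul r x _ hx => exact smul γ r x hx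

theorem one_mem_gdeg : (1 : SymmetricAlgebra R M) ∈ gdeg 𝓜 g 0 :=
  Submodule.subset_span ⟨[], by simp, by simp, by simp⟩

theorem ι_mem_gdeg {d : ℕ} {m : M} (hm : m ∈ 𝓜 d) : ι R M m ∈ gdeg 𝓜 g (g d) :=
  Submodule.subset_span ⟨[(d, m)], by simpa using hm, by simp, by simp⟩

theorem gdeg_mul {γ δ : G} {x y : SymmetricAlgebra R M} (hx : x ∈ gdeg 𝓜 g γ)
    (hy : y ∈ gdeg 𝓜 g δ) : x * y ∈ gdeg 𝓜 g (γ + δ) := by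
  have := Submodule.mul_mem_mul hx hy
  rw [gdeg, gdeg, Submodule.span_mul_span] at this
  refine Submodule.span_mono ?_ this
  rintro _ ⟨_, ⟨l, hl, rfl, rfl⟩, _, ⟨l', hl', rfl, rfl⟩, rfl⟩
  refine ⟨l ++ l', ?_, by simp, by simp⟩
  intro z hz
  rcases List.mem_append.1 hz with h | h
  exacts [hl z h, hl' z h]

instance : SetLike.GradedMonoid (gdeg 𝓜 g) where
  one_mem := one_mem_gdeg
  mul_mem _ _ _ _ hx hy := gdeg_mul hx hy

section decomposition

variable [DecidableEq G] [DirectSum.Decomposition 𝓜]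

variable (𝓜 g) in
/-- The decomposition of elements of `S(M)` into homogeneous components. -/
noncomputable def gdegDecompose : SymmetricAlgebra R M →ₐ[R] ⨁ γ, gdeg 𝓜 g γ :=
  lift ((DirectSum.toModule R ℕ (⨁ γ, gdeg 𝓜 g γ) fun d =>
    DirectSum.lof R G (fun γ => gdeg 𝓜 g γ) (g d) ∘ₗ
      ((ι R M).restrict fun _ hm => ι_mem_gdeg hm : 𝓜 d →ₗ[R] gdeg 𝓜 g (g d))) ∘ₗ
    (DirectSum.decomposeLinearEquiv 𝓜).toLinearMap)

theorem gdegDecompose_ι {d : ℕ} {m : M} (hm : m ∈ 𝓜 d) :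
    gdegDecompose 𝓜 g (ι R M m) =
      DirectSum.of (fun γ => gdeg 𝓜 g γ) (g d) ⟨ι R M m, ι_mem_gdeg hm⟩ := by
  rw [gdegDecompose, lift_ι_apply, LinearMap.comp_apply, LinearEquiv.coe_coe,
    DirectSum.decomposeLinearEquiv_apply, DirectSum.decompose_of_mem 𝓜 hm, ← DirectSum.lof_eq_of R,
    DirectSum.toModule_lof]
  rfl

theorem gdegDecompose_of_mem {γ : G} {x : SymmetricAlgebra R M} (hx : x ∈ gdeg 𝓜 g γ) :
    gdegDecompose 𝓜 g x = DirectSum.of (fun γ => gdeg 𝓜 g γ) γ ⟨x, hx⟩ := by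
  -- The membership proof goes inside the motive because the degree and the element vary along the
  -- induction.
  suffices h : ∃ hx : x ∈ gdeg 𝓜 g γ,
      gdegDecompose 𝓜 g x = DirectSum.of (fun γ => gdeg 𝓜 g γ) γ ⟨x, hx⟩ from h.2
  refine gdeg_induction (motive := fun γ x => ∃ hx : x ∈ gdeg 𝓜 g γ,
      gdegDecompose 𝓜 g x = DirectSum.of (fun γ => gdeg 𝓜 g γ) γ ⟨x, hx⟩) ?_ ?_ ?_ ?_ ?_ hx
  · intro γ
    refine ⟨zero_mem _, ?_⟩
    rw [map_zero]
    exact (map_zero _).symm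
  · exact ⟨one_mem_gdeg, map_one _⟩
  · rintro d m hm γ y - ⟨hy, h⟩
    refine ⟨gdeg_mul (ι_mem_gdeg hm) hy, ?_⟩
    rw [map_mul, h, gdegDecompose_ι hm, DirectSum.of_mul_of]
    rfl
  · rintro γ x y ⟨hx, h⟩ ⟨hy, h'⟩
    refine ⟨add_mem hx hy, ?_⟩
    rw [map_add, h, h', ← map_add]
    rfl
  · rintro γ r x ⟨hx, h⟩
    refine ⟨Submodule.smul_mem _ r hx, ?_⟩
    rw [map_smul, h, ← DirectSum.lof_eq_of R, ← map_smul]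
    rfl

/-- A grading of `M` and a weight on the degrees give a grading of `S(M)`. -/
noncomputable instance : GradedAlgebra (gdeg 𝓜 g) :=
  GradedAlgebra.ofAlgHom _ (gdegDecompose 𝓜 g)
    (by
      apply algHom_ext
      apply DirectSum.decompose_lhom_ext 𝓜
      intro d
      ext m
      change DirectSum.coeAlgHom _ (gdegDecompose 𝓜 g (ι R M m)) = ι R M m
      rw [gdegDecompose_ι m.2, DirectSum.coeAlgHom_of])
    (fun γ x => gdegDecompose_of_mem x.2)

theorem iSup_gdeg : ⨆ γ, gdeg 𝓜 g γ = ⊤ :=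
  (DirectSum.Decomposition.isInternal (gdeg 𝓜 g)).submodule_iSup_eq_top

end decomposition

/-- A weight with values in `ℕ × ℕ` records both degrees at once, so the grading built for an
arbitrary additive weight also yields the bigrading. -/
theorem bideg_eq_gdeg (𝓜 : ℕ → Submodule R M) (w : ℕ → ℕ) (p q : ℕ) :
    bideg 𝓜 w p q = gdeg 𝓜 (fun d => (w d, d)) (p, q) := by
  have (l : List (ℕ × M)) : (l.map fun z => (w z.1, z.1)).sum =
      ((l.map fun z => w z.1).sum, (l.map fun z => z.1).sum) := by
    induction l with
    | nil => rfl
    | cons z l ih => simp [ih]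
  simp only [bideg, gdeg, this, Prod.mk.injEq, and_assoc]

theorem iSup_bideg_eq_gdeg (𝓜 : ℕ → Submodule R M) (w : ℕ → ℕ) (q : ℕ) :
    ⨆ p, bideg 𝓜 w p q = gdeg 𝓜 id q := by
  refine le_antisymm (iSup_le fun p => Submodule.span_mono ?_) (Submodule.span_le.2 ?_)
  · rintro _ ⟨l, hl, -, h, rfl⟩
    exact ⟨l, hl, h, rfl⟩
  · rintro _ ⟨l, hl, h, rfl⟩
    exact Submodule.mem_iSup_of_mem _ (Submodule.subset_span ⟨l, hl, rfl, h, rfl⟩)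

theorem bideg_induction {𝓜 : ℕ → Submodule R M} {w : ℕ → ℕ}
    {motive : ℕ → ℕ → SymmetricAlgebra R M → Prop}
    (zero : ∀ p q, motive p q 0) (one : motive 0 0 1)
    (ι_mul : ∀ d, ∀ m ∈ 𝓜 d, ∀ p q, ∀ y ∈ bideg 𝓜 w p q, motive p q y →
      motive (w d + p) (d + q) (ι R M m * y))
    (add : ∀ p q x y, motive p q x → motive p q y → motive p q (x + y))
    (smul : ∀ p q (r : R) x, motive p q x → motive p q (r • x))
    {p q : ℕ} {x : SymmetricAlgebra R M} (hx : x ∈ bideg 𝓜 w p q) : motive p q x := by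
  rw [bideg_eq_gdeg] at hx
  exact gdeg_induction (motive := fun γ x => motive γ.1 γ.2 x) (fun _ => zero _ _) one
    (fun d m hm γ y hy h => ι_mul d m hm γ.1 γ.2 y (by rwa [bideg_eq_gdeg]) h)
    (fun γ => add γ.1 γ.2) (fun γ => smul γ.1 γ.2) hx

theorem iSup_bideg (𝓜 : ℕ → Submodule R M) (w : ℕ → ℕ) [DirectSum.Decomposition 𝓜] :
    ⨆ i : ℕ × ℕ, bideg 𝓜 w i.1 i.2 = ⊤ := by
  simp only [bideg_eq_gdeg, Prod.mk.eta]
  exact iSup_gdeg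

/-- The bigrading of `S(M)`. -/
theorem nonempty_gradedAlgebra_bideg (𝓜 : ℕ → Submodule R M) (w : ℕ → ℕ)
    [DirectSum.Decomposition 𝓜] :
    Nonempty (GradedAlgebra fun i : ℕ × ℕ => bideg 𝓜 w i.1 i.2) := by
  have h : (fun i : ℕ × ℕ => bideg 𝓜 w i.1 i.2) = gdeg 𝓜 fun d => (w d, d) :=
    funext fun i => bideg_eq_gdeg 𝓜 w i.1 i.2
  rw [h]
  exact ⟨inferInstance⟩

end grading

/-! ### Ring homomorphisms out of symmetric algebras -/

section liftRingHom

variable {R M S : Type*} [CommRing R] [AddCommGroup M] [Module R M] [CommRing S]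

/-- The ring homomorphism out of `S(M)` that is given by `σ` on scalars and by `f` on `M`. -/
noncomputable def liftRingHom (σ : R →+* S) (f : M →+ S) (hf : ∀ r m, f (r • m) = σ r * f m) :
    SymmetricAlgebra R M →+* S :=
  letI := σ.toAlgebra
  (lift (R := R) (A := S) { f with map_smul' := fun r m => hf r m }).toRingHom

variable {σ : R →+* S} {f : M →+ S} (hf : ∀ r m, f (r • m) = σ r * f m)

theorem liftRingHom_ι (m : M) : liftRingHom σ f hf (ι R M m) = f m := by
  let _ := σ.toAlgebra
  exact lift_ι_apply (R := R) (A := S) _ m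

theorem liftRingHom_algebraMap (r : R) : liftRingHom σ f hf (algebraMap R _ r) = σ r := by
  let _ := σ.toAlgebra
  exact (lift (R := R) (A := S) _).commutes r

end liftRingHom

end SymmetricAlgebra

/-! ### The grading of the Poisson envelope -/

namespace SymmetricAlgebra

section

variable {k 𝔤 : Type*} [CommRing k] [LieRing 𝔤] [LieAlgebra k 𝔤]

theorem lieBracket_one_left (x : SymmetricAlgebra k 𝔤) : lieBracket 1 x = 0 := by
  have := lieBracket_algebraMap_left 1 x
  rwa [map_one] at this

theorem lieBracket_one_right (x : SymmetricAlgebra k 𝔤) : lieBracket x 1 = 0 := by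
  rw [lieBracket_skew, lieBracket_one_left, neg_zero]

/-- The bracket is a biderivation, so the claim reduces to generators, first in the second variable
(`key`) and then in the first. -/
theorem lieBracket_mem_gdeg {𝓜 : ℕ → Submodule k 𝔤}
    (h : ∀ i j, ∀ x ∈ 𝓜 i, ∀ y ∈ 𝓜 j, ⁅x, y⁆ ∈ 𝓜 (i + j + 1)) {i j : ℕ}
    {x y : SymmetricAlgebra k 𝔤} (hx : x ∈ gdeg 𝓜 id i) (hy : y ∈ gdeg 𝓜 id j) :
    lieBracket x y ∈ gdeg 𝓜 id (i + j + 1) := by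
  have key (d : ℕ) (m : 𝔤) (hm : m ∈ 𝓜 d) : lieBracket (ι k 𝔤 m) y ∈ gdeg 𝓜 id (d + j + 1) := by
    refine gdeg_induction (motive := fun j y => lieBracket (ι k 𝔤 m) y ∈ gdeg 𝓜 id (d + j + 1))
      ?_ ?_ ?_ ?_ ?_ hy
    · intro j
      rw [map_zero]
      exact zero_mem _
    · rw [lieBracket_one_right]
      exact zero_mem _
    · intro e m' hm' j y hy ih
      rw [lieBracket_mul_right, lieBracket_ι]
      refine add_mem ?_ ?_
      · rw [show d + (id e + j) + 1 = id (d + e + 1) + j by simp only [id]; omega]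
        exact gdeg_mul (ι_mem_gdeg (h _ _ _ hm _ hm')) hy
      · rw [show d + (id e + j) + 1 = id e + (d + j + 1) by simp only [id]; omega]
        exact gdeg_mul (ι_mem_gdeg hm') ih
    · intro j y y' ih ih'
      rw [map_add]
      exact add_mem ih ih'
    · intro j r y ih
      rw [map_smul]
      exact Submodule.smul_mem _ r ih
  refine gdeg_induction (motive := fun i x => lieBracket x y ∈ gdeg 𝓜 id (i + j + 1))
      ?_ ?_ ?_ ?_ ?_ hx
  · intro i
    rw [map_zero]
    exact zero_mem _
  · rw [lieBracket_one_left]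
    exact zero_mem _
  · intro e m hm i x hx ih
    rw [lieBracket_mul_left]
    refine add_mem ?_ ?_
    · rw [show id e + i + j + 1 = id e + (i + j + 1) by ring]
      exact gdeg_mul (ι_mem_gdeg hm) ih
    · rw [show id e + i + j + 1 = i + (id e + j + 1) by ring]
      exact gdeg_mul hx (key e m hm)
  · intro i x x' ih ih'
    rw [map_add]
    exact add_mem ih ih'
  · intro i r x ih
    rw [map_smul]
    exact Submodule.smul_mem _ r ih

end

end SymmetricAlgebra

namespace FreePoisson

variable {k V : Type*} [CommRing k] [AddCommGroup V] [Module k V]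

theorem deg_eq_gdeg (q : ℕ) :
    deg k V q = SymmetricAlgebra.gdeg (FreeLie.deg k V) id q :=
  SymmetricAlgebra.iSup_bideg_eq_gdeg _ _ q

theorem bideg_le_deg (p q : ℕ) : bideg k V p q ≤ deg k V q := le_iSup (fun p => bideg k V p q) p

variable (k V) in
theorem filt_zero : filt k V 0 = ⊤ := by
  rw [eq_top_iff, ← SymmetricAlgebra.iSup_bideg (FreeLie.deg k V) fun d => if d = 0 then 0 else 1]
  exact iSup_le fun i => bideg_le_filt (Nat.zero_le _) _

theorem ofSym_mem_deg (x : SymmetricAlgebra k V) : ofSym k V x ∈ deg k V 0 := by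
  rw [deg_eq_gdeg]
  induction x using SymmetricAlgebra.induction with
  | algebraMap r =>
    rw [AlgHom.commutes, Algebra.algebraMap_eq_smul_one]
    exact Submodule.smul_mem _ r SymmetricAlgebra.one_mem_gdeg
  | ι v =>
    rw [ofSym_ι]
    exact SymmetricAlgebra.ι_mem_gdeg (g := id) (FreeLie.ι_mem_deg k V v)
  | mul x y hx hy =>
    have := SymmetricAlgebra.gdeg_mul hx hy
    rwa [← map_mul, add_zero] at this
  | add x y hx hy =>
    rw [map_add]
    exact add_mem hx hy

/-- The component of degree `q`. -/
noncomputable def degProj (q : ℕ) : FreePoisson k V →+ FreePoisson k V :=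
  GradedRing.proj (SymmetricAlgebra.gdeg (FreeLie.deg k V) id) q

theorem degProj_of_mem {q : ℕ} {x : FreePoisson k V} (hx : x ∈ deg k V q) : degProj q x = x := by
  rw [deg_eq_gdeg] at hx
  exact DirectSum.decompose_of_mem_same _ hx

theorem degProj_of_mem_ne {q q' : ℕ} (h : q ≠ q') {x : FreePoisson k V} (hx : x ∈ deg k V q') :
    degProj q x = 0 := by
  rw [deg_eq_gdeg] at hx
  exact DirectSum.decompose_of_mem_ne _ hx h.symm

theorem degProj_mul_of_mem_zero (q : ℕ) {x : FreePoisson k V} (hx : x ∈ deg k V 0)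
    (y : FreePoisson k V) : degProj q (x * y) = x * degProj q y := by
  rw [deg_eq_gdeg] at hx
  exact DirectSum.coe_decompose_mul_of_left_mem_zero _ hx

theorem degProj_smul (q : ℕ) (r : k) (x : FreePoisson k V) : degProj q (r • x) = r • degProj q x := by
  have : algebraMap k (FreePoisson k V) r ∈ deg k V 0 := by
    rw [← (ofSym k V).commutes]
    exact ofSym_mem_deg _
  rw [Algebra.smul_def, Algebra.smul_def, degProj_mul_of_mem_zero q this]

/-- The filtration is spanned by bihomogeneous elements, and the projection fixes each of them or
kills it. -/
theorem degProj_mem_filt (q : ℕ) {n : ℕ} {x : FreePoisson k V} (hx : x ∈ filt k V n) :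
    degProj q x ∈ filt k V n := by
  let f : FreePoisson k V →ₗ[k] FreePoisson k V :=
    { degProj q with map_smul' := degProj_smul q }
  have h : filt k V n ≤ (filt k V n).comap f := by
    refine filt_le fun p q' hp x hx => ?_
    change degProj q x ∈ filt k V n
    obtain rfl | hq := eq_or_ne q q'
    · rw [degProj_of_mem (bideg_le_deg _ _ hx)]
      exact bideg_le_filt hp _ hx
    · rw [degProj_of_mem_ne hq (bideg_le_deg _ _ hx)]
      exact zero_mem _
  exact h hx

end FreePoisson

namespace PoissonEnvelope

variable {k A : Type*} [CommRing k] [CommRing A] [Algebra k A]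

variable (k A) in
-- The homogeneous core of the ideal is again a Poisson ideal, and it contains the generators `I A`
-- because they have degree `0`. By minimality it is the whole ideal.
theorem ideal_isHomogeneous :
    (ideal k A).IsHomogeneous (SymmetricAlgebra.gdeg (FreeLie.deg k A) id) := by
  set 𝒢 := SymmetricAlgebra.gdeg (FreeLie.deg k A) (id : ℕ → ℕ)
  have hP := PoissonAlgebra.isPoissonIdeal_poissonSpan k (FreePoisson.ofSym k A '' symKer k A)
  rw [Ideal.IsHomogeneous.iff_eq]
  refine le_antisymm (Ideal.toIdeal_homogeneousCore_le _ _) ?_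
  refine PoissonAlgebra.poissonSpan_le k ?_ ?_
  · intro a x hx
    -- The core is spanned by the homogeneous elements of the ideal. The bracket of such an element
    -- with a homogeneous one is homogeneous and stays in the ideal; coefficients are handled by the
    -- Leibniz rule.
    change x ∈ Submodule.span _ _ at hx
    induction hx using Submodule.span_induction with
    | mem x hx =>
      obtain ⟨⟨x, i, hxi⟩, hx, rfl⟩ := hx
      have ha : a ∈ ⨆ q, 𝒢 q := by
        rw [SymmetricAlgebra.iSup_gdeg]
        trivial
      induction ha using Submodule.iSup_induction' with
      | zero => rw [map_zero]; exact zero_mem _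
      | add a b _ _ ha hb => rw [map_add]; exact add_mem ha hb
      | mem j a ha =>
        refine Ideal.mem_homogeneousCore_of_homogeneous_of_mem ⟨j + i + 1, ?_⟩ (hP _ _ hx)
        exact SymmetricAlgebra.lieBracket_mem_gdeg
          (fun _ _ _ hx _ hy => FreeLie.lie_mem_deg hx hy) ha hxi
    | zero => rw [map_zero]; exact zero_mem _
    | add x y _ _ hx hy => rw [map_add]; exact add_mem hx hy
    | smul b x hb hx =>
      rw [smul_eq_mul, PoissonAlgebra.leibniz]
      exact add_mem (Ideal.mul_mem_left _ _ hb) (Ideal.mul_mem_left _ _ hx)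
  · rintro _ ⟨x, hx, rfl⟩
    refine Ideal.mem_homogeneousCore_of_homogeneous_of_mem ⟨0, ?_⟩
      (PoissonAlgebra.subset_poissonSpan k _ ⟨x, hx, rfl⟩)
    have := FreePoisson.ofSym_mem_deg x
    rwa [FreePoisson.deg_eq_gdeg] at this

theorem proj_degProj_congr (q : ℕ) {x y : FreePoisson k A} (h : proj k A x = proj k A y) :
    proj k A (FreePoisson.degProj q x) = proj k A (FreePoisson.degProj q y) := by
  rw [← sub_eq_zero, ← map_sub, proj_eq_zero] at h ⊢
  rw [← map_sub]
  exact ideal_isHomogeneous k A q h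

variable (k A) in
theorem proj_surjective : Function.Surjective (proj k A) := Ideal.Quotient.mk_surjective

variable (k A) in
/-- The projection of `P A` onto its component of degree `q`. -/
noncomputable def degProj (q : ℕ) : PoissonEnvelope k A →ₗ[A] PoissonEnvelope k A where
  -- The choice of the preimage does not matter, by `proj_degProj_congr`.
  toFun x := proj k A (FreePoisson.degProj q (Function.surjInv (proj_surjective k A) x))
  map_add' x y := by
    rw [← map_add, ← map_add]
    apply proj_degProj_congr
    rw [map_add]
    simp only [Function.surjInv_eq]
  map_smul' a x := by
    rw [RingHom.id_apply, smul_proj, ← FreePoisson.degProj_mul_of_mem_zero q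
      (FreePoisson.bideg_le_deg _ _ (FreePoisson.ι_mem_bideg_zero a))]
    apply proj_degProj_congr
    rw [← smul_proj]
    simp only [Function.surjInv_eq]

theorem degProj_proj (q : ℕ) (x : FreePoisson k A) :
    degProj k A q (proj k A x) = proj k A (FreePoisson.degProj q x) :=
  proj_degProj_congr q (Function.surjInv_eq _ _)

theorem degProj_of_mem {q : ℕ} {x : PoissonEnvelope k A} (hx : x ∈ deg k A q) :
    degProj k A q x = x := by
  obtain ⟨y, hy, rfl⟩ := hx
  rw [degProj_proj, FreePoisson.degProj_of_mem hy]

theorem degProj_of_mem_ne {q q' : ℕ} (h : q ≠ q') {x : PoissonEnvelope k A}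
    (hx : x ∈ deg k A q') : degProj k A q x = 0 := by
  obtain ⟨y, hy, rfl⟩ := hx
  rw [degProj_proj, FreePoisson.degProj_of_mem_ne h hy, map_zero]

theorem degProj_mem_filt (q n : ℕ) {x : PoissonEnvelope k A} (hx : x ∈ filt k A n) :
    degProj k A q x ∈ filt k A n := by
  obtain ⟨y, hy, rfl⟩ := hx
  rw [degProj_proj]
  exact ⟨_, FreePoisson.degProj_mem_filt q hy, rfl⟩

theorem proj_mem_deg {q : ℕ} {x : FreePoisson k A} (hx : x ∈ FreePoisson.deg k A q) :
    proj k A x ∈ deg k A q := ⟨x, hx, rfl⟩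

theorem proj_mem_filt {n : ℕ} {x : FreePoisson k A} (hx : x ∈ FreePoisson.filt k A n) :
    proj k A x ∈ filt k A n := ⟨x, hx, rfl⟩

theorem proj_mem_filt_of_mem_bideg {p q : ℕ} {x : FreePoisson k A}
    (hx : x ∈ FreePoisson.bideg k A p q) : proj k A x ∈ filt k A p :=
  proj_mem_filt (FreePoisson.bideg_le_filt le_rfl q hx)

theorem mul_mem_deg {q q' : ℕ} {x y : PoissonEnvelope k A} (hx : x ∈ deg k A q)
    (hy : y ∈ deg k A q') : x * y ∈ deg k A (q + q') := by
  obtain ⟨x, hx, rfl⟩ := hx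
  obtain ⟨y, hy, rfl⟩ := hy
  rw [← map_mul]
  apply proj_mem_deg
  rw [FreePoisson.deg_eq_gdeg] at *
  exact SymmetricAlgebra.gdeg_mul hx hy

variable (k A) in
theorem one_mem_deg : (1 : PoissonEnvelope k A) ∈ deg k A 0 := by
  rw [← map_one (proj k A)]
  apply proj_mem_deg
  rw [FreePoisson.deg_eq_gdeg]
  exact SymmetricAlgebra.one_mem_gdeg

instance : IsScalarTower k A (PoissonEnvelope k A) :=
  IsScalarTower.of_algebraMap_eq fun r => ((of k A).commutes r).symm

variable (k A) in
theorem filt_zero : filt k A 0 = ⊤ := by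
  rw [eq_top_iff]
  rintro x -
  obtain ⟨x, rfl⟩ := proj_surjective k A x
  apply proj_mem_filt
  rw [FreePoisson.filt_zero]
  trivial

end PoissonEnvelope

/-! ### The bigrading of the associated graded algebra -/

namespace AssocGraded

section

variable {A P : Type*} [CommRing A] [CommRing P] [Algebra A P] {F : ℕ → Submodule A P}

theorem cls_eq_zero {n : ℕ} {x : P} (hx : x ∈ F n) (h : x ∈ F (n + 1)) : cls F n ⟨x, hx⟩ = 0 := by
  rw [cls, LinearMap.comp_apply, toPiece_eq_zero.2 h, map_zero]

theorem eq_zero_of_cls_eq_zero {n : ℕ} {x : F n} (h : cls F n x = 0) : (x : P) ∈ F (n + 1) := by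
  rw [cls, LinearMap.comp_apply, DirectSum.lof_eq_of] at h
  exact toPiece_eq_zero.1 (DirectSum.of_injective (β := Piece F) n (h.trans (map_zero _).symm))

/-- The endomorphism of `F p / F (p + 1)` induced by a filtered map. -/
def pieceMap (f : P →ₗ[A] P) (hf : ∀ n, ∀ x ∈ F n, f x ∈ F n) (p : ℕ) :
    Piece F p →ₗ[A] Piece F p :=
  Submodule.mapQ ((F (p + 1)).comap (F p).subtype) ((F (p + 1)).comap (F p).subtype)
    (f.restrict (hf p)) (fun x hx => hf (p + 1) x hx)

theorem pieceMap_toPiece (f : P →ₗ[A] P) (hf : ∀ n, ∀ x ∈ F n, f x ∈ F n) (p : ℕ) (x : F p) :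
    pieceMap f hf p (toPiece F p x) = toPiece F p ⟨f x, hf p x x.2⟩ := rfl

/-- The endomorphism of the associated graded module that is induced by `f` on the `p`-th piece and
is `0` on the other pieces. -/
noncomputable def pieceProj (f : P →ₗ[A] P) (hf : ∀ n, ∀ x ∈ F n, f x ∈ F n) (p : ℕ) :
    AssocGraded F →ₗ[A] AssocGraded F :=
  DirectSum.lof A ℕ (Piece F) p ∘ₗ pieceMap f hf p ∘ₗ DirectSum.component A ℕ (Piece F) p

theorem pieceProj_cls (f : P →ₗ[A] P) (hf : ∀ n, ∀ x ∈ F n, f x ∈ F n) (p : ℕ) (x : F p) :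
    pieceProj f hf p (cls F p x) = cls F p ⟨f x, hf p x x.2⟩ := by
  simp only [pieceProj, cls, LinearMap.comp_apply, DirectSum.component.lof_self, pieceMap_toPiece]

theorem pieceProj_cls_ne (f : P →ₗ[A] P) (hf : ∀ n, ∀ x ∈ F n, f x ∈ F n) {p p' : ℕ} (h : p ≠ p')
    (x : F p') : pieceProj f hf p (cls F p' x) = 0 := by
  simp only [pieceProj, cls, LinearMap.comp_apply]
  rw [DirectSum.component.of, dif_neg h.symm, map_zero, map_zero]

variable [hF : IsDescendingFiltration F]

theorem cls_mul_cls {p p' : ℕ} (x : F p) (y : F p') :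
    cls F p x * cls F p' y = cls F (p + p') ⟨x * y, hF.mul_mem x.2 y.2⟩ :=
  DirectSum.of_mul_of _ _

theorem cls_one : cls F 0 ⟨1, hF.one_mem⟩ = 1 := rfl

end

end AssocGraded

namespace GrPoissonEnvelope

open PoissonEnvelope AssocGraded

variable {k A : Type*} [CommRing k] [CommRing A] [Algebra k A]

theorem cls_proj_mem_bideg {p q : ℕ} {x : FreePoisson k A} (hx : x ∈ FreePoisson.bideg k A p q) :
    cls (filt k A) p ⟨proj k A x, proj_mem_filt_of_mem_bideg hx⟩ ∈ bideg k A p q :=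
  Submodule.mem_map_of_mem (show proj k A x ∈ deg k A q from
    proj_mem_deg (FreePoisson.bideg_le_deg p q hx))

/-- A submodule of `G P A` that contains the classes of the elements of bidegree `(p, q)` of the
free Poisson algebra is everything. -/
theorem eq_top_of_cls_proj_mem (N : Submodule A (GrPoissonEnvelope k A))
    (h : ∀ p q x, ∀ hx : x ∈ FreePoisson.bideg k A p q,
      cls (filt k A) p ⟨proj k A x, proj_mem_filt_of_mem_bideg hx⟩ ∈ N) : N = ⊤ := by
  have key (p : ℕ) (x : FreePoisson k A) (hx : x ∈ FreePoisson.filt k A p) :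
      cls (filt k A) p ⟨proj k A x, proj_mem_filt hx⟩ ∈ N := by
    -- The filtration is a supremum of `k`-submodules, so the claim is phrased as an inclusion into
    -- a `k`-submodule; membership in the filtration is part of the condition.
    let W : Submodule k (FreePoisson k A) :=
      { carrier := {x | ∃ hx : proj k A x ∈ filt k A p, cls (filt k A) p ⟨proj k A x, hx⟩ ∈ N}
        add_mem' := by
          rintro x y ⟨hx, hx'⟩ ⟨hy, hy'⟩
          have hxy : proj k A (x + y) ∈ filt k A p := by
            rw [map_add]
            exact add_mem hx hy
          refine ⟨hxy, ?_⟩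
          convert add_mem hx' hy'
          rw [← map_add]
          exact congrArg _ (Subtype.ext (map_add _ _ _))
        zero_mem' := by
          have h0 : proj k A 0 ∈ filt k A p := by rw [map_zero]; exact zero_mem _
          refine ⟨h0, ?_⟩
          rw [cls_eq_zero h0 (by rw [map_zero]; exact zero_mem _)]
          exact zero_mem _
        smul_mem' := by
          rintro r x ⟨hx, hx'⟩
          have e : proj k A (r • x) = algebraMap k A r • proj k A x := by
            rw [map_smul, algebraMap_smul]
          have hrx : proj k A (r • x) ∈ filt k A p := by
            rw [e]
            exact Submodule.smul_mem _ _ hx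
          refine ⟨hrx, ?_⟩
          convert Submodule.smul_mem _ (algebraMap k A r) hx'
          rw [← map_smul]
          exact congrArg _ (Subtype.ext e) }
    have hW : FreePoisson.filt k A p ≤ W := by
      refine FreePoisson.filt_le fun p' q hp y hy => ?_
      obtain rfl | hp := hp.eq_or_lt
      · exact ⟨_, h _ _ _ hy⟩
      -- A component with more than `p` positive factors already lies in `H^(p+1)`, so its class in
      -- `H^p / H^(p+1)` vanishes.
      · refine ⟨proj_mem_filt (FreePoisson.bideg_le_filt hp.le q hy), ?_⟩
        rw [cls_eq_zero _ (proj_mem_filt (FreePoisson.bideg_le_filt hp q hy))]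
        exact zero_mem _
    exact (hW hx).2
  rw [eq_top_iff]
  rintro x -
  induction x using DirectSum.induction_on with
  | zero => exact zero_mem _
  | add x y hx hy => exact add_mem hx hy
  | of p x =>
    obtain ⟨⟨_, x, hx, rfl⟩, rfl⟩ := toPiece_surjective _ p x
    exact key p x hx

theorem iSup_bideg : ⨆ i : ℕ × ℕ, bideg k A i.1 i.2 = ⊤ :=
  eq_top_of_cls_proj_mem _ fun p q _ hx =>
    Submodule.mem_iSup_of_mem (p, q) (cls_proj_mem_bideg hx)

/-- The projection onto bidegree `(p, q)` takes the `p`-th piece and applies to it the map induced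
by the projection of `P A` onto degree `q`, which respects the filtration. -/
theorem iSupIndep_bideg : iSupIndep fun i : ℕ × ℕ => bideg k A i.1 i.2 := by
  refine iSupIndep_of_projections _
    (fun i => pieceProj (degProj k A i.2) (fun n _ hx => degProj_mem_filt i.2 n hx) i.1) ?_ ?_
  · rintro ⟨p, q⟩ _ ⟨x, hx, rfl⟩
    rw [pieceProj_cls]
    congr 1
    exact Subtype.ext (degProj_of_mem hx)
  · rintro ⟨p, q⟩ ⟨p', q'⟩ h _ ⟨x, hx, rfl⟩
    obtain rfl | hp := eq_or_ne p p'
    · have hq : q ≠ q' := fun hq => h (by rw [hq])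
      rw [pieceProj_cls]
      have h0 : degProj k A q x = 0 := degProj_of_mem_ne hq hx
      refine cls_eq_zero _ ?_
      change degProj k A q x ∈ _
      rw [h0]
      exact zero_mem _
    · exact pieceProj_cls_ne _ _ hp x

instance : SetLike.GradedMonoid fun i : ℕ × ℕ => bideg k A i.1 i.2 where
  one_mem := by
    rw [← cls_one]
    exact Submodule.mem_map_of_mem (one_mem_deg k A)
  mul_mem := by
    rintro ⟨p, q⟩ ⟨p', q'⟩ _ _ ⟨x, hx, rfl⟩ ⟨y, hy, rfl⟩
    rw [cls_mul_cls]
    exact Submodule.mem_map_of_mem (mul_mem_deg hx hy)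

variable (k A) in
theorem nonempty_gradedAlgebra_bideg :
    Nonempty (GradedAlgebra fun i : ℕ × ℕ => bideg k A i.1 i.2) :=
  ⟨{ DirectSum.IsInternal.chooseDecomposition _
      (DirectSum.isInternal_submodule_of_iSupIndep_of_iSup_eq_top
        (iSupIndep_bideg (k := k) (A := A)) iSup_bideg) with }⟩

end GrPoissonEnvelope

/-! ### The cotangent Lie algebra of an augmented Poisson algebra -/

namespace PoissonAlgebra

/-- The Lie algebra underlying a Poisson algebra. -/
def AsLie (_k P : Type*) : Type _ := P

namespace AsLie

variable (k P : Type*) [CommRing k] [CommRing P] [Algebra k P]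

instance : AddCommGroup (AsLie k P) := inferInstanceAs (AddCommGroup P)

instance : Module k (AsLie k P) := inferInstanceAs (Module k P)

/-- The identity map. -/
def of : P ≃ₗ[k] AsLie k P := LinearEquiv.refl k P

variable [PoissonAlgebra k P]

instance : LieRing (AsLie k P) where
  bracket x y := of k P (bracket (k := k) ((of k P).symm x) ((of k P).symm y))
  add_lie x y z := by simp only [map_add, LinearMap.add_apply]
  lie_add x y z := by simp only [map_add]
  lie_self x := by rw [bracket_self, map_zero]
  leibniz_lie x y z := by
    simp only [LinearEquiv.symm_apply_apply]
    rw [← map_add, jacobi]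

instance : LieAlgebra k (AsLie k P) where
  lie_smul r x y := by
    change of k P (bracket (k := k) _ _) = _ • of k P (bracket (k := k) _ _)
    simp only [map_smul]

variable {k P}

theorem lie_of (x y : P) : ⁅of k P x, of k P y⁆ = of k P (bracket (k := k) x y) := rfl

end AsLie

section cotangent

variable {k A P : Type*} [CommRing k] [CommRing A] [Algebra k A] [CommRing P] [Algebra k P]
  [PoissonAlgebra k P] (ε : P →ₐ[k] A) (hε : ∀ x y, ε (bracket (k := k) x y) = 0)

/-- The Lie ideal of `A ⊗ P` that expresses the Leibniz rule with respect to the augmentation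
`ε : P → A`. -/
def leibnizIdeal : LieIdeal A (A ⊗[k] AsLie k P) :=
  { Submodule.span A {z | ∃ f g : P, z = (1 : A) ⊗ₜ[k] AsLie.of k P (f * g) -
      ε f ⊗ₜ[k] AsLie.of k P g - ε g ⊗ₜ[k] AsLie.of k P f} with
    lie_mem := by
      intro x m hm
      change m ∈ Submodule.span A _ at hm
      change _ ∈ Submodule.span A _
      induction hm using Submodule.span_induction with
      | zero => rw [lie_zero]; exact zero_mem _
      | add m m' _ _ h h' => rw [lie_add]; exact add_mem h h'
      | smul a m _ h => rw [lie_smul]; exact Submodule.smul_mem _ a h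
      | mem m hm =>
        obtain ⟨f, g, rfl⟩ := hm
        induction x using TensorProduct.induction_on with
        | zero => rw [zero_lie]; exact zero_mem _
        | add x y hx hy => rw [add_lie]; exact add_mem hx hy
        | tmul a h =>
          obtain ⟨h, rfl⟩ := (AsLie.of k P).surjective h
          -- Bracketing the relation for `(f, g)` with `a ⊗ h` gives `a` times the sum of the
          -- relations for `({h, f}, g)` and `(f, {h, g})`; the superfluous terms contain `ε{h, f}`
          -- or `ε{h, g}` and vanish.
          have h1 := Submodule.smul_mem _ a (Submodule.subset_span
            (s := {z | ∃ f g : P, z = (1 : A) ⊗ₜ[k] AsLie.of k P (f * g) -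
              ε f ⊗ₜ[k] AsLie.of k P g - ε g ⊗ₜ[k] AsLie.of k P f})
            ⟨bracket (k := k) h f, g, rfl⟩)
          have h2 := Submodule.smul_mem _ a (Submodule.subset_span
            (s := {z | ∃ f g : P, z = (1 : A) ⊗ₜ[k] AsLie.of k P (f * g) -
              ε f ⊗ₜ[k] AsLie.of k P g - ε g ⊗ₜ[k] AsLie.of k P f})
            ⟨f, bracket (k := k) h g, rfl⟩)
          convert add_mem h1 h2 using 1
          simp only [lie_sub, LieAlgebra.ExtendScalars.bracket_tmul, AsLie.lie_of, leibniz, hε,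
            TensorProduct.zero_tmul, map_add, TensorProduct.tmul_add, smul_sub,
            TensorProduct.smul_tmul', smul_eq_mul, mul_one, smul_zero]
          abel }

/-- The fibre `A ⊗ Ω_P` of the module of differentials of `P` along the augmentation `ε`, with the
`A`-Lie algebra structure `[df, dg] = d{f, g}`. -/
def Cotangent : Type _ := (A ⊗[k] AsLie k P) ⧸ leibnizIdeal ε hε

namespace Cotangent

instance : LieRing (Cotangent ε hε) :=
  inferInstanceAs (LieRing ((A ⊗[k] AsLie k P) ⧸ leibnizIdeal ε hε))

instance : LieAlgebra A (Cotangent ε hε) :=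
  inferInstanceAs (LieAlgebra A ((A ⊗[k] AsLie k P) ⧸ leibnizIdeal ε hε))

instance : Module k (Cotangent ε hε) :=
  inferInstanceAs (Module k ((A ⊗[k] AsLie k P) ⧸ (leibnizIdeal ε hε).toSubmodule))

instance : IsScalarTower k A (Cotangent ε hε) :=
  inferInstanceAs (IsScalarTower k A ((A ⊗[k] AsLie k P) ⧸ (leibnizIdeal ε hε).toSubmodule))

/-- The quotient map. -/
def mk : A ⊗[k] AsLie k P →ₗ[A] Cotangent ε hε := (leibnizIdeal ε hε).toSubmodule.mkQ

theorem mk_lie (x y : A ⊗[k] AsLie k P) : mk ε hε ⁅x, y⁆ = ⁅mk ε hε x, mk ε hε y⁆ := rfl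

/-- The universal differential. -/
def d : P →ₗ[k] Cotangent ε hε :=
  (mk ε hε).restrictScalars k ∘ₗ TensorProduct.mk k A (AsLie k P) 1 ∘ₗ (AsLie.of k P).toLinearMap

theorem d_apply (f : P) : d ε hε f = mk ε hε (1 ⊗ₜ AsLie.of k P f) := rfl

theorem d_bracket (f g : P) : d ε hε (bracket (k := k) f g) = ⁅d ε hε f, d ε hε g⁆ := by
  rw [d_apply, d_apply, d_apply, ← mk_lie, LieAlgebra.ExtendScalars.bracket_tmul, AsLie.lie_of,
    one_mul]

theorem d_mul (f g : P) : d ε hε (f * g) = ε f • d ε hε g + ε g • d ε hε f := by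
  simp only [d_apply, ← map_smul, ← map_add]
  rw [← sub_eq_zero, ← map_sub]
  refine (Submodule.Quotient.mk_eq_zero _).2 (Submodule.subset_span ⟨f, g, ?_⟩)
  simp only [TensorProduct.smul_tmul', smul_eq_mul, mul_one]
  abel

/-- The map out of the cotangent Lie algebra that corresponds to a derivation. -/
def desc {N X : Type*} [AddCommGroup N] [Module A N] [Module k N] [IsScalarTower k A N]
    [AddCommGroup X] [Module A X] (g : P →ₗ[k] N) (c : N →ₗ[A] X)
    (hc : ∀ f f' : P, c (g (f * f')) = ε f • c (g f') + ε f' • c (g f)) :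
    Cotangent ε hε →ₗ[A] X :=
  Submodule.liftQ (leibnizIdeal ε hε).toSubmodule
    (c ∘ₗ LinearMap.liftBaseChange A (g ∘ₗ (AsLie.of k P).symm.toLinearMap)) (by
      change Submodule.span A _ ≤ _
      rw [Submodule.span_le]
      rintro _ ⟨f, f', rfl⟩
      simp [hc])

theorem desc_d {N X : Type*} [AddCommGroup N] [Module A N] [Module k N] [IsScalarTower k A N]
    [AddCommGroup X] [Module A X] (g : P →ₗ[k] N) (c : N →ₗ[A] X)
    (hc : ∀ f f' : P, c (g (f * f')) = ε f • c (g f') + ε f' • c (g f)) (f : P) :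
    desc ε hε g c hc (d ε hε f) = c (g f) := by
  change c (LinearMap.liftBaseChange A (g ∘ₗ (AsLie.of k P).symm.toLinearMap)
    (1 ⊗ₜ AsLie.of k P f)) = _
  simp

/-- The map from the Kähler differentials of `A` to the cotangent Lie algebra, for a section of
the augmentation. -/
noncomputable def ofKaehler (j : A →ₐ[k] P) (hj : ∀ a, ε (j a) = a) :
    Ω[A⁄k] →ₗ[A] Cotangent ε hε :=
  Derivation.liftKaehlerDifferential (Derivation.mk' (d ε hε ∘ₗ j.toLinearMap) fun a b => by
    simp [d_mul, hj])

theorem ofKaehler_D (j : A →ₐ[k] P) (hj : ∀ a, ε (j a) = a) (a : A) :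
    ofKaehler ε hε j hj (KaehlerDifferential.D k A a) = d ε hε (j a) := by
  rw [ofKaehler, Derivation.liftKaehlerDifferential_comp_D]
  rfl

end Cotangent

end cotangent

end PoissonAlgebra

/-! ### The augmentation of the Poisson envelope -/

theorem SymmetricAlgebra.map_lieBracket_eq_zero {k 𝔤 B : Type*} [CommRing k] [LieRing 𝔤]
    [LieAlgebra k 𝔤] [CommRing B] (ε : SymmetricAlgebra k 𝔤 →+* B)
    (h : ∀ x y : 𝔤, ε (ι k 𝔤 ⁅x, y⁆) = 0) (x y : SymmetricAlgebra k 𝔤) : ε (lieBracket x y) = 0 := by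
  induction x using SymmetricAlgebra.induction with
  | algebraMap r => rw [lieBracket_algebraMap_left, map_zero]
  | ι x =>
    induction y using SymmetricAlgebra.induction with
    | algebraMap r => rw [lieBracket_algebraMap_right, map_zero]
    | ι y => rw [lieBracket_ι, h]
    | mul a b ha hb => rw [lieBracket_mul_right, map_add, map_mul, map_mul, ha, hb]; ring
    | add a b ha hb => rw [map_add, map_add, ha, hb, add_zero]
  | mul a b ha hb => rw [lieBracket_mul_left, map_add, map_mul, map_mul, ha, hb]; ring
  | add a b ha hb => rw [map_add, LinearMap.add_apply, map_add, ha, hb, add_zero]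

namespace FreeLie

section

attribute [local instance 100] LieRing.ofAssociativeRing

/-- The projection of the free Lie algebra on `A` onto its degree `0` part `A`. -/
noncomputable def counit (k A : Type*) [CommRing k] [CommRing A] [Algebra k A] :
    FreeLie k A →ₗ[k] A :=
  (lift (LinearMap.id : A →ₗ[k] A) : FreeLie k A →ₗ⁅k⁆ A)

variable {k A : Type*} [CommRing k] [CommRing A] [Algebra k A]

theorem counit_ι (a : A) : counit k A (ι k A a) = a := lift_ι (LinearMap.id : A →ₗ[k] A) a

/-- `A` is regarded as a Lie algebra under the commutator, which is zero because `A` is commutative.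
-/
theorem counit_lie (x y : FreeLie k A) : counit k A ⁅x, y⁆ = 0 := by
  change (lift (LinearMap.id : A →ₗ[k] A) : FreeLie k A →ₗ⁅k⁆ A) ⁅x, y⁆ = 0
  rw [LieHom.map_lie, LieRing.of_associative_ring_bracket, mul_comm, sub_self]

end

theorem counit_of_mem_deg_succ {k A : Type*} [CommRing k] [CommRing A] [Algebra k A] {n : ℕ}
    {x : FreeLie k A} (hx : x ∈ deg k A (n + 1)) : counit k A x = 0 := by
  have : deg k A (n + 1) ≤ LinearMap.ker (counit k A) := by
    rw [deg_succ, Submodule.span_le]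
    rintro _ ⟨m, y, -, rfl⟩
    exact counit_lie _ _
  exact this hx

end FreeLie

namespace FreePoisson

variable {k A : Type*} [CommRing k] [CommRing A] [Algebra k A]

variable (k A) in
/-- The augmentation `S L A → A`. -/
noncomputable def aug : FreePoisson k A →ₐ[k] A := SymmetricAlgebra.lift (FreeLie.counit k A)

theorem aug_ι (x : FreeLie k A) : aug k A (SymmetricAlgebra.ι k _ x) = FreeLie.counit k A x :=
  SymmetricAlgebra.lift_ι_apply _ x

theorem aug_ofSym (x : SymmetricAlgebra k A) :
    aug k A (ofSym k A x) = SymmetricAlgebra.lift (LinearMap.id : A →ₗ[k] A) x := by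
  have : (aug k A).comp (ofSym k A) = SymmetricAlgebra.lift (LinearMap.id : A →ₗ[k] A) := by
    apply SymmetricAlgebra.algHom_ext
    ext a
    simp [ofSym_ι, aug_ι, FreeLie.counit_ι]
  exact DFunLike.congr_fun this x

theorem aug_lieBracket (x y : FreePoisson k A) :
    aug k A (SymmetricAlgebra.lieBracket x y) = 0 :=
  SymmetricAlgebra.map_lieBracket_eq_zero (aug k A : FreePoisson k A →+* A)
    (fun x y => (aug_ι _).trans (FreeLie.counit_lie x y)) x y

end FreePoisson

namespace PoissonEnvelope

variable {k A : Type*} [CommRing k] [CommRing A] [Algebra k A]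

variable (k A) in
-- The kernel contains all brackets, hence is a Poisson ideal, and on `S A` the augmentation is the
-- projection to `A`.
theorem ideal_le_ker_aug : ideal k A ≤ RingHom.ker (FreePoisson.aug k A) := by
  refine PoissonAlgebra.poissonSpan_le k (fun a x _ => FreePoisson.aug_lieBracket a x) ?_
  rintro _ ⟨x, hx, rfl⟩
  exact (FreePoisson.aug_ofSym x).trans hx

variable (k A) in
/-- The augmentation `P A → A`. -/
noncomputable def aug : PoissonEnvelope k A →ₐ[k] A :=
  Ideal.Quotient.liftₐ (ideal k A) (FreePoisson.aug k A) (ideal_le_ker_aug k A)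

theorem aug_proj (x : FreePoisson k A) : aug k A (proj k A x) = FreePoisson.aug k A x := rfl

theorem bracket_proj (x y : FreePoisson k A) :
    PoissonAlgebra.bracket (k := k) (proj k A x) (proj k A y) =
      proj k A (SymmetricAlgebra.lieBracket x y) := rfl

theorem aug_bracket (x y : PoissonEnvelope k A) :
    aug k A (PoissonAlgebra.bracket (k := k) x y) = 0 := by
  obtain ⟨x, rfl⟩ := proj_surjective k A x
  obtain ⟨y, rfl⟩ := proj_surjective k A y
  exact FreePoisson.aug_lieBracket x y

theorem of_eq (a : A) : of k A a = proj k A (SymmetricAlgebra.ι k _ (FreeLie.ι k A a)) := rfl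

theorem aug_of (a : A) : aug k A (of k A a) = a := by
  rw [of_eq, aug_proj, FreePoisson.aug_ι, FreeLie.counit_ι]

/-- For products, with `ε` the augmentation, use `xy - ε(x)ε(y) = (x - ε(x)) y + ε(x) (y - ε(y))`,
so that only generators remain. Those of degree `0` contribute nothing; those of positive degree lie
in `H^1` and are killed by `ε`. -/
theorem sub_of_aug_mem_filt (x : PoissonEnvelope k A) : x - of k A (aug k A x) ∈ filt k A 1 := by
  obtain ⟨x, rfl⟩ := proj_surjective k A x
  induction x using SymmetricAlgebra.induction with
  | algebraMap r =>
    rw [AlgHom.commutes, AlgHom.commutes, AlgHom.commutes, sub_self]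
    exact zero_mem _
  | ι x =>
    have hx : x ∈ ⨆ n, FreeLie.deg k A n := by rw [FreeLie.iSup_deg]; trivial
    induction hx using Submodule.iSup_induction' with
    | zero => simp
    | add x y _ _ hx hy =>
      simp only [map_add, add_sub_add_comm]
      exact add_mem hx hy
    | mem n x hx =>
      obtain _ | n := n
      · obtain ⟨a, rfl⟩ := hx
        rw [← of_eq, aug_of, sub_self]
        exact zero_mem _
      · rw [aug_proj, FreePoisson.aug_ι, FreeLie.counit_of_mem_deg_succ hx, map_zero, sub_zero]
        apply proj_mem_filt_of_mem_bideg (q := n + 1)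
        exact SymmetricAlgebra.ι_mem_bideg (by simp) hx
  | mul x y hx hy =>
    simp only [map_mul]
    have h1 := IsDescendingFiltration.mul_mem (F := filt k A) (m := 1) (n := 0) hx
      (y := proj k A y) (by rw [filt_zero]; trivial)
    have h2 := IsDescendingFiltration.mul_mem (F := filt k A) (m := 0) (n := 1)
      (x := of k A (aug k A (proj k A x))) (by rw [filt_zero]; trivial) hy
    convert add_mem h1 h2 using 1
    ring
  | add x y hx hy =>
    simp only [map_add, add_sub_add_comm]
    exact add_mem hx hy

end PoissonEnvelope

/-! ### The comparison map -/

namespace GrPoissonEnvelope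

open PoissonEnvelope AssocGraded PoissonAlgebra

variable (k A : Type*) [CommRing k] [CommRing A] [Algebra k A]

/-- The projection of `P A` onto the augmentation ideal `H^1`. -/
noncomputable def toFiltOne : PoissonEnvelope k A →ₗ[k] filt k A 1 where
  toFun x := ⟨x - of k A (aug k A x), sub_of_aug_mem_filt x⟩
  map_add' x y := Subtype.ext (by
    simp only [map_add, Submodule.coe_add]
    abel)
  map_smul' r x := Subtype.ext (by
    simp only [map_smul, RingHom.id_apply, Submodule.coe_smul_of_tower, smul_sub])

/-- The two sides differ by the class of `(x - ε(x)) (y - ε(y))`, a product of two elements of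
`H^1`. This is the Leibniz rule needed to map out of the cotangent Lie algebra. -/
theorem cls_toFiltOne_mul (x y : PoissonEnvelope k A) :
    cls (filt k A) 1 (toFiltOne k A (x * y)) = aug k A x • cls (filt k A) 1 (toFiltOne k A y) +
      aug k A y • cls (filt k A) 1 (toFiltOne k A x) := by
  rw [← (cls (filt k A) 1).map_smul, ← (cls (filt k A) 1).map_smul, ← (cls (filt k A) 1).map_add,
    ← sub_eq_zero, ← (cls (filt k A) 1).map_sub]
  refine cls_eq_zero _ ?_
  have h := IsDescendingFiltration.mul_mem (F := filt k A) (sub_of_aug_mem_filt x)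
    (sub_of_aug_mem_filt y)
  convert h using 1
  change x * y - of k A (aug k A (x * y)) - (of k A (aug k A x) * (y - of k A (aug k A y)) +
    of k A (aug k A y) * (x - of k A (aug k A x))) = _
  rw [map_mul, map_mul]
  ring

/-- The map from the cotangent Lie algebra of `P A` to `H^1 / H^2`. -/
noncomputable def ofCotangent :
    Cotangent (aug k A) aug_bracket →ₗ[A] GrPoissonEnvelope k A :=
  Cotangent.desc _ _ (toFiltOne k A) (cls (filt k A) 1) (cls_toFiltOne_mul k A)

/-- The `A`-Lie algebra homomorphism to the cotangent Lie algebra of `P A`, `da ↦ da`. -/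
noncomputable def lieToCotangent :
    FreeLie A Ω[A⁄k] →ₗ⁅A⁆ Cotangent (aug k A) aug_bracket :=
  FreeLie.lift (Cotangent.ofKaehler (aug k A) aug_bracket (of k A) aug_of)

/-- The comparison map from the symmetric algebra on the free `A`-Lie algebra to `G P A`. -/
noncomputable def comparison : SymLieKaehler k A →ₐ[A] GrPoissonEnvelope k A :=
  SymmetricAlgebra.lift (ofCotangent k A ∘ₗ
    (lieToCotangent k A : FreeLie A Ω[A⁄k] →ₗ[A] Cotangent (aug k A) aug_bracket) ∘ₗ
    (FreeLie.plus A Ω[A⁄k]).subtype)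

end GrPoissonEnvelope

/-- The universal derivation as a semilinear map. -/
noncomputable def kaehlerD (k A : Type*) [CommRing k] [CommRing A] [Algebra k A] :
    A →ₛₗ[algebraMap k A] Ω[A⁄k] where
  toFun := KaehlerDifferential.D k A
  map_add' := map_add _
  map_smul' r a := by rw [Derivation.map_smul, algebraMap_smul]

theorem kaehlerD_apply {k A : Type*} [CommRing k] [CommRing A] [Algebra k A] (a : A) :
    kaehlerD k A a = KaehlerDifferential.D k A a := rfl

/-! ### Free Lie algebras and the universal derivation -/

namespace FreeLie

section

variable {k A : Type*} [CommRing k] [CommRing A] [Algebra k A]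

theorem map_nested {R M R' M' X : Type*} [CommRing R] [AddCommGroup M] [Module R M] [CommRing R']
    [AddCommGroup M'] [Module R' M'] {σ : R →+* R'} (g : M →ₛₗ[σ] M') (d : X → M) (a : X)
    (l : List X) : map g (nested d a l) = nested (fun x => g (d x)) a l := by
  induction l generalizing a with
  | nil => exact map_ι g _
  | cons b l ih => rw [nested, map_lie, ih, map_ι, nested]

/-- Exact differentials span `Ω_A` over `A` and the bracket is `A`-bilinear, so all coefficients can
be pulled out. -/
theorem deg_le_span_map_kaehlerD (n : ℕ) :
    deg A Ω[A⁄k] n ≤ Submodule.span A (map (kaehlerD k A) '' (deg k A n : Set (FreeLie k A))) := by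
  have hι (ω : Ω[A⁄k]) :
      ω ∈ Submodule.span A (Set.range (KaehlerDifferential.D k A)) := by
    rw [KaehlerDifferential.span_range_derivation]
    trivial
  induction n with
  | zero =>
    rintro _ ⟨ω, rfl⟩
    have hω := hι ω
    induction hω using Submodule.span_induction with
    | mem ω h =>
      obtain ⟨a, rfl⟩ := h
      exact Submodule.subset_span ⟨_, ι_mem_deg k A a, map_ι _ a⟩
    | zero => rw [map_zero]; exact zero_mem _
    | add x y _ _ hx hy => rw [map_add]; exact add_mem hx hy
    | smul r x _ hx => rw [map_smul]; exact Submodule.smul_mem _ r hx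
  | succ n ih =>
    rw [deg_succ, Submodule.span_le]
    rintro _ ⟨ω, y, hy, rfl⟩
    have hω := hι ω
    have hy' := ih hy
    clear hy
    induction hω using Submodule.span_induction with
    | mem ω h =>
      obtain ⟨a, rfl⟩ := h
      induction hy' using Submodule.span_induction with
      | mem y h =>
        obtain ⟨y, hy, rfl⟩ := h
        refine Submodule.subset_span ⟨⁅ι k A a, y⁆, Submodule.subset_span ⟨a, y, hy, rfl⟩, ?_⟩
        rw [map_lie, map_ι]
        rfl
      | zero => rw [lie_zero]; exact zero_mem _
      | add x y _ _ hx hy => rw [lie_add]; exact add_mem hx hy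
      | smul r x _ hx => rw [lie_smul]; exact Submodule.smul_mem _ r hx
    | zero => rw [map_zero, zero_lie]; exact zero_mem _
    | add x y _ _ hx hy => rw [map_add, add_lie]; exact add_mem hx hy
    | smul r x _ hx => rw [map_smul, smul_lie]; exact Submodule.smul_mem _ r hx

theorem plusMap_plusProj {R M R' M' : Type*} [CommRing R] [AddCommGroup M] [Module R M]
    [CommRing R'] [AddCommGroup M'] [Module R' M'] {σ : R →+* R'} (g : M →ₛₗ[σ] M')
    (x : FreeLie R M) : plusMap g (plusProj R M x) = plusProj R' M' (map g x) := by
  have hx : x ∈ ⨆ n, deg R M n := by rw [iSup_deg]; trivial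
  induction hx using Submodule.iSup_induction' with
  | zero => simp only [map_zero]
  | add x y _ _ hx hy => simp only [map_add, hx, hy]
  | mem n x hx =>
    obtain _ | n := n
    · obtain ⟨m, rfl⟩ := hx
      rw [map_ι, plusProj_ι, plusProj_ι, map_zero]
    · rw [plusProj_of_mem_plus (deg_succ_le_plus n hx),
        plusProj_of_mem_plus (deg_succ_le_plus n (map_mem_deg g _ hx))]
      rfl

theorem counit_map {B : Type*} [CommRing B] [Algebra k B] (f : A →ₐ[k] B) (x : FreeLie k A) :
    counit k B (map f.toLinearMap x) = f (counit k A x) := by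
  induction x using induction with
  | ι a => rw [map_ι, counit_ι, counit_ι]; rfl
  | add x y hx hy => simp only [map_add, hx, hy]
  | smul r x hx => simp only [map_smul, hx]
  | lie x y _ _ => rw [map_lie, counit_lie, counit_lie, map_zero]

theorem map_kaehlerMap {B : Type*} [CommRing B] [Algebra k B] (f : A →ₐ[k] B) (x : FreeLie k A) :
    map (kaehlerMap f) (map (kaehlerD k A) x) = map (kaehlerD k B) (map f.toLinearMap x) := by
  induction x using induction with
  | ι a =>
    rw [map_ι, map_ι, map_ι, map_ι]
    exact congrArg _ (kaehlerMap_D f a)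
  | add x y hx hy => simp only [map_add, hx, hy]
  | smul r x hx =>
    rw [(map (kaehlerD k A)).map_smulₛₗ, (map (kaehlerMap f)).map_smulₛₗ, hx,
      (map f.toLinearMap).map_smulₛₗ, (map (kaehlerD k B)).map_smulₛₗ]
    congr 1
    exact f.commutes r
  | lie x y hx hy => simp only [map_lie, hx, hy]

end

end FreeLie

/-! ### From the free Poisson algebra to the symmetric algebra on `L_+` -/

namespace SymLieKaehler

variable (k A : Type*) [CommRing k] [CommRing A] [Algebra k A]

/-- The canonical homomorphism from the free Poisson algebra on `A` to the symmetric algebra on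
the whole free `A`-Lie algebra on `Ω_A`. -/
noncomputable def ofFreePoissonFull :
    FreePoisson k A →+* SymmetricAlgebra A (FreeLie A Ω[A⁄k]) :=
  SymmetricAlgebra.liftRingHom
    ((algebraMap A (SymmetricAlgebra A (FreeLie A Ω[A⁄k]))).comp (algebraMap k A))
    { toFun := fun x => algebraMap A _ (FreeLie.counit k A x) +
        SymmetricAlgebra.ι A _ (FreeLie.map (kaehlerD k A) x)
      map_zero' := by simp only [map_zero, add_zero]
      map_add' := fun x y => by
        simp only [map_add]
        abel }
    (fun r x => by
      change algebraMap A (SymmetricAlgebra A (FreeLie A Ω[A⁄k])) (FreeLie.counit k A (r • x)) +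
        SymmetricAlgebra.ι A _ (FreeLie.map (kaehlerD k A) (r • x)) =
        algebraMap A (SymmetricAlgebra A (FreeLie A Ω[A⁄k])) (algebraMap k A r) *
          (algebraMap A (SymmetricAlgebra A (FreeLie A Ω[A⁄k])) (FreeLie.counit k A x) +
            SymmetricAlgebra.ι A _ (FreeLie.map (kaehlerD k A) x))
      rw [(FreeLie.counit k A).map_smul, (FreeLie.map (kaehlerD k A)).map_smulₛₗ,
        LinearMap.map_smul, Algebra.smul_def r, map_mul, mul_add,
        Algebra.smul_def (algebraMap k A r)])

/-- The homomorphism of symmetric algebras induced by the projection onto `L_+`. -/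
noncomputable def ofFull : SymmetricAlgebra A (FreeLie A Ω[A⁄k]) →ₐ[A] SymLieKaehler k A :=
  SymmetricAlgebra.lift (SymmetricAlgebra.ι A _ ∘ₗ FreeLie.plusProj A Ω[A⁄k])

/-- The canonical homomorphism from the free Poisson algebra on `A`. -/
noncomputable def ofFreePoisson : FreePoisson k A →+* SymLieKaehler k A :=
  (ofFull k A : SymmetricAlgebra A (FreeLie A Ω[A⁄k]) →+* SymLieKaehler k A).comp
    (ofFreePoissonFull k A)

variable {k A}

theorem ofFreePoissonFull_ι (x : FreeLie k A) :
    ofFreePoissonFull k A (SymmetricAlgebra.ι k _ x) = algebraMap A _ (FreeLie.counit k A x) +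
      SymmetricAlgebra.ι A _ (FreeLie.map (kaehlerD k A) x) :=
  SymmetricAlgebra.liftRingHom_ι _ x

theorem ofFreePoissonFull_algebraMap (r : k) :
    ofFreePoissonFull k A (algebraMap k _ r) = algebraMap A _ (algebraMap k A r) :=
  SymmetricAlgebra.liftRingHom_algebraMap _ r

theorem ofFreePoisson_apply (x : FreePoisson k A) :
    ofFreePoisson k A x = ofFull k A (ofFreePoissonFull k A x) := rfl

theorem ofFreePoisson_ι (x : FreeLie k A) :
    ofFreePoisson k A (SymmetricAlgebra.ι k _ x) = algebraMap A _ (FreeLie.counit k A x) +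
      SymmetricAlgebra.ι A _ (FreeLie.plusProj A _ (FreeLie.map (kaehlerD k A) x)) := by
  rw [ofFreePoisson_apply, ofFreePoissonFull_ι, map_add, AlgHom.commutes, ofFull,
    SymmetricAlgebra.lift_ι_apply, LinearMap.comp_apply]

theorem ofFreePoisson_algebraMap (r : k) :
    ofFreePoisson k A (algebraMap k _ r) = algebraMap A _ (algebraMap k A r) := by
  rw [ofFreePoisson_apply, ofFreePoissonFull_algebraMap, AlgHom.commutes]

theorem ofFreePoisson_smul (r : k) (x : FreePoisson k A) :
    ofFreePoisson k A (r • x) = algebraMap k A r • ofFreePoisson k A x := by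
  rw [Algebra.smul_def, map_mul, ofFreePoisson_algebraMap, ← Algebra.smul_def]

theorem ofFreePoisson_ι_ι (a : A) :
    ofFreePoisson k A (SymmetricAlgebra.ι k _ (FreeLie.ι k A a)) = algebraMap A _ a := by
  rw [ofFreePoisson_ι, FreeLie.map_ι, FreeLie.plusProj_ι, map_zero, add_zero, FreeLie.counit_ι]

theorem ofFreePoisson_ι_of_mem {n : ℕ} {x : FreeLie k A} (hx : x ∈ FreeLie.deg k A (n + 1)) :
    ofFreePoisson k A (SymmetricAlgebra.ι k _ x) =
      SymmetricAlgebra.ι A _ ⟨FreeLie.map (kaehlerD k A) x,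
        FreeLie.deg_succ_le_plus n (FreeLie.map_mem_deg _ _ hx)⟩ := by
  rw [ofFreePoisson_ι, FreeLie.counit_of_mem_deg_succ hx, map_zero, zero_add,
    FreeLie.plusProj_of_mem_plus (FreeLie.deg_succ_le_plus n (FreeLie.map_mem_deg _ _ hx))]

/-- Stated with `plusProj` so that the span induction need not carry membership in `L_+`. A
coefficient `a` is realised by multiplication with the generator `a`, which has bidegree `(0, 0)`.
-/
theorem exists_ofFreePoisson_ι_plusProj {n : ℕ} {x : FreeLie A Ω[A⁄k]}
    (hx : x ∈ FreeLie.deg A Ω[A⁄k] (n + 1)) : ∃ z ∈ FreePoisson.bideg k A 1 (n + 1),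
      ofFreePoisson k A z = SymmetricAlgebra.ι A _ (FreeLie.plusProj A _ x) := by
  have hx' := FreeLie.deg_le_span_map_kaehlerD _ hx
  clear hx
  induction hx' using Submodule.span_induction with
  | mem x hx =>
    obtain ⟨x, hx, rfl⟩ := hx
    refine ⟨SymmetricAlgebra.ι k _ x, SymmetricAlgebra.ι_mem_bideg (by simp) hx, ?_⟩
    rw [ofFreePoisson_ι, FreeLie.counit_of_mem_deg_succ hx, map_zero, zero_add]
  | zero => exact ⟨0, zero_mem _, by simp only [map_zero]⟩
  | add x y _ _ hx hy =>
    obtain ⟨z, hz, h⟩ := hx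
    obtain ⟨z', hz', h'⟩ := hy
    exact ⟨z + z', add_mem hz hz', by simp only [map_add, h, h']⟩
  | smul a x _ hx =>
    obtain ⟨z, hz, h⟩ := hx
    refine ⟨SymmetricAlgebra.ι k _ (FreeLie.ι k A a) * z, ?_, ?_⟩
    · have := SymmetricAlgebra.bideg_mul (FreePoisson.ι_mem_bideg_zero a) hz
      rwa [zero_add, zero_add] at this
    · rw [map_mul, h, ofFreePoisson_ι_ι, ← Algebra.smul_def, map_smul, map_smul]

/-- Homogeneous elements can thus be lifted to `S L A` without changing the bidegree; statements
about `comparison` are checked there. -/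
theorem exists_ofFreePoisson_eq {p q : ℕ} {x : SymLieKaehler k A} (hx : x ∈ bideg k A p q) :
    ∃ z ∈ FreePoisson.bideg k A p q, ofFreePoisson k A z = x := by
  refine SymmetricAlgebra.bideg_induction
    (motive := fun p q x => ∃ z ∈ FreePoisson.bideg k A p q, ofFreePoisson k A z = x)
    ?_ ?_ ?_ ?_ ?_ hx
  · exact fun p q => ⟨0, zero_mem _, map_zero _⟩
  · exact ⟨1, SymmetricAlgebra.one_mem_bideg _ _, map_one _⟩
  · rintro d m hm p q y - ⟨z, hz, rfl⟩
    suffices h : ∃ z ∈ FreePoisson.bideg k A 1 d,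
        ofFreePoisson k A z = SymmetricAlgebra.ι A _ m by
      obtain ⟨z', hz', h'⟩ := h
      exact ⟨z' * z, SymmetricAlgebra.bideg_mul hz' hz, by rw [map_mul, h']⟩
    obtain _ | d := d
    · rw [FreeLie.plusDeg_zero, Submodule.mem_bot] at hm
      exact ⟨0, zero_mem _, by rw [hm, map_zero, map_zero]⟩
    · obtain ⟨z, hz, h⟩ := exists_ofFreePoisson_ι_plusProj hm
      exact ⟨z, hz, by rw [h, Submodule.subtype_apply, FreeLie.plusProj_of_mem_plus m.2]⟩
  · rintro p q x y ⟨z, hz, rfl⟩ ⟨z', hz', rfl⟩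
    exact ⟨z + z', add_mem hz hz', map_add _ _ _⟩
  · rintro p q a x ⟨z, hz, rfl⟩
    refine ⟨SymmetricAlgebra.ι k _ (FreeLie.ι k A a) * z, ?_, ?_⟩
    · have := SymmetricAlgebra.bideg_mul (FreePoisson.ι_mem_bideg_zero a) hz
      rwa [zero_add, zero_add] at this
    · rw [map_mul, ofFreePoisson_ι_ι, ← Algebra.smul_def]

theorem map_ofFreePoisson {B : Type*} [CommRing B] [Algebra k B] (f : A →ₐ[k] B)
    (x : FreePoisson k A) :
    SymLieKaehler.map f (ofFreePoisson k A x) =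
      ofFreePoisson k B (FreePoisson.map f.toLinearMap x) := by
  induction x using SymmetricAlgebra.induction with
  | algebraMap r =>
    rw [ofFreePoisson_algebraMap, FreePoisson.map, SymmetricAlgebra.mapSemilinear_algebraMap,
      ofFreePoisson_algebraMap, SymLieKaehler.map, SymmetricAlgebra.mapSemilinear_algebraMap]
    congr 1
    exact f.commutes r
  | ι x =>
    rw [ofFreePoisson_ι, FreePoisson.map, SymmetricAlgebra.mapSemilinear_ι, ofFreePoisson_ι,
      SymLieKaehler.map, map_add, SymmetricAlgebra.mapSemilinear_algebraMap,
      SymmetricAlgebra.mapSemilinear_ι, FreeLie.plusMap_plusProj, FreeLie.map_kaehlerMap,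
      FreeLie.counit_map]
    rfl
  | mul x y hx hy => simp only [map_mul, hx, hy]
  | add x y hx hy => simp only [map_add, hx, hy]

end SymLieKaehler

/-! ### Surjectivity, bidegrees and naturality of the comparison map -/

namespace GrPoissonEnvelope

open PoissonEnvelope AssocGraded PoissonAlgebra

section

variable {k A : Type*} [CommRing k] [CommRing A] [Algebra k A]

/-- Both sides respect brackets and scalars from `k`, and they agree on generators. -/
theorem lieToCotangent_map (x : FreeLie k A) :
    lieToCotangent k A (FreeLie.map (kaehlerD k A) x) =
      Cotangent.d (aug k A) aug_bracket (proj k A (SymmetricAlgebra.ι k _ x)) := by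
  induction x using FreeLie.induction with
  | ι a =>
    rw [FreeLie.map_ι, lieToCotangent, FreeLie.lift_ι, kaehlerD_apply, Cotangent.ofKaehler_D]
    rfl
  | add x y hx hy => simp only [map_add, hx, hy]
  | smul r x hx =>
    rw [map_smulₛₗ, map_smul, hx, map_smul, map_smul, map_smul, algebraMap_smul]
  | lie x y hx hy =>
    rw [FreeLie.map_lie, LieHom.map_lie, hx, hy, ← SymmetricAlgebra.lieBracket_ι, ← bracket_proj,
      Cotangent.d_bracket]

theorem comparison_ofFreePoisson_ι {d : ℕ} {x : FreeLie k A} (hx : x ∈ FreeLie.deg k A d) :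
    ∃ h : proj k A (SymmetricAlgebra.ι k _ x) ∈ filt k A (if d = 0 then 0 else 1),
      comparison k A (SymLieKaehler.ofFreePoisson k A (SymmetricAlgebra.ι k _ x)) =
        cls (filt k A) _ ⟨_, h⟩ := by
  refine ⟨proj_mem_filt_of_mem_bideg (SymmetricAlgebra.ι_mem_bideg rfl hx), ?_⟩
  obtain _ | d := d
  · obtain ⟨a, rfl⟩ := hx
    rw [SymLieKaehler.ofFreePoisson_ι_ι, AlgHom.commutes, Algebra.algebraMap_eq_smul_one,
      ← cls_one, ← map_smul]
    exact congrArg _ (Subtype.ext (mul_one _))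
  · rw [SymLieKaehler.ofFreePoisson_ι_of_mem hx, comparison, SymmetricAlgebra.lift_ι_apply,
      LinearMap.comp_apply, LinearMap.comp_apply]
    change ofCotangent k A (lieToCotangent k A (FreeLie.map (kaehlerD k A) x)) = _
    rw [lieToCotangent_map, ofCotangent, Cotangent.desc_d]
    -- An element of positive degree has augmentation `0`, so subtracting its augmentation does not
    -- change it.
    refine congrArg _ (Subtype.ext ?_)
    change _ - of k A (aug k A _) = _
    rw [aug_proj, FreePoisson.aug_ι, FreeLie.counit_of_mem_deg_succ hx, map_zero, sub_zero]

/-- Both sides are multiplicative, which leaves single generators: a scalar `a` in degree `0`, an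
iterated bracket in positive degree. Surjectivity, bidegrees, naturality and the bracket formula all
rest on this identity. -/
theorem comparison_ofFreePoisson {p q : ℕ} {x : FreePoisson k A}
    (hx : x ∈ FreePoisson.bideg k A p q) :
    comparison k A (SymLieKaehler.ofFreePoisson k A x) =
      cls (filt k A) p ⟨proj k A x, proj_mem_filt_of_mem_bideg hx⟩ := by
  suffices h : ∃ h : proj k A x ∈ filt k A p,
      comparison k A (SymLieKaehler.ofFreePoisson k A x) = cls (filt k A) p ⟨proj k A x, h⟩ from h.2
  refine SymmetricAlgebra.bideg_induction (motive := fun p q x => ∃ h : proj k A x ∈ filt k A p,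
      comparison k A (SymLieKaehler.ofFreePoisson k A x) = cls (filt k A) p ⟨proj k A x, h⟩)
    ?_ ?_ ?_ ?_ ?_ hx
  · intro p q
    have h0 : proj k A 0 ∈ filt k A p := by rw [map_zero]; exact zero_mem _
    refine ⟨h0, ?_⟩
    rw [cls_eq_zero h0 (by rw [map_zero]; exact zero_mem _), map_zero, map_zero]
  · have h1 : proj k A 1 ∈ filt k A 0 := by rw [filt_zero]; trivial
    refine ⟨h1, ?_⟩
    rw [map_one, map_one, ← cls_one]
    exact congrArg _ (Subtype.ext (map_one (proj k A)).symm)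
  · rintro d m hm p q y - ⟨hy, h⟩
    obtain ⟨hm', h'⟩ := comparison_ofFreePoisson_ι hm
    have hmy : proj k A (SymmetricAlgebra.ι k _ m * y) ∈ filt k A ((if d = 0 then 0 else 1) + p) := by
      rw [map_mul]
      exact IsDescendingFiltration.mul_mem hm' hy
    refine ⟨hmy, ?_⟩
    rw [map_mul, map_mul, h, h', cls_mul_cls]
    exact congrArg _ (Subtype.ext (map_mul (proj k A) _ _).symm)
  · rintro p q x y ⟨hx, h⟩ ⟨hy, h'⟩
    have hxy : proj k A (x + y) ∈ filt k A p := by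
      rw [map_add]
      exact add_mem hx hy
    refine ⟨hxy, ?_⟩
    rw [map_add, map_add, h, h', ← map_add]
    exact congrArg _ (Subtype.ext (map_add (proj k A) _ _).symm)
  · rintro p q r x ⟨hx, h⟩
    have e : proj k A (r • x) = algebraMap k A r • proj k A x := by
      rw [map_smul, algebraMap_smul]
    have hrx : proj k A (r • x) ∈ filt k A p := by
      rw [e]
      exact Submodule.smul_mem _ _ hx
    refine ⟨hrx, ?_⟩
    rw [SymLieKaehler.ofFreePoisson_smul, map_smul, h, ← map_smul]
    exact congrArg _ (Subtype.ext e.symm)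

variable (k A) in
theorem comparison_surjective : Function.Surjective (comparison k A) := by
  have : LinearMap.range (comparison k A).toLinearMap = ⊤ :=
    eq_top_of_cls_proj_mem _ fun p q x hx => ⟨_, comparison_ofFreePoisson hx⟩
  exact LinearMap.range_eq_top.1 this

theorem comparison_mem_bideg {p q : ℕ} {x : SymLieKaehler k A}
    (hx : x ∈ SymLieKaehler.bideg k A p q) : comparison k A x ∈ bideg k A p q := by
  obtain ⟨z, hz, rfl⟩ := SymLieKaehler.exists_ofFreePoisson_eq hx
  rw [comparison_ofFreePoisson hz]
  exact cls_proj_mem_bideg hz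

/-- By additivity it suffices to treat a bihomogeneous element; after lifting it to `S L A`, both
sides are the class of the image of the lift under the functorial map. -/
theorem comparison_map {B : Type*} [CommRing B] [Algebra k B] (f : A →ₐ[k] B)
    (x : SymLieKaehler k A) :
    comparison k B (SymLieKaehler.map f x) = GrPoissonEnvelope.map f (comparison k A x) := by
  have hx : x ∈ ⨆ i : ℕ × ℕ, SymLieKaehler.bideg k A i.1 i.2 := by
    simp only [SymLieKaehler.bideg]
    rw [SymmetricAlgebra.iSup_bideg]
    trivial
  induction hx using Submodule.iSup_induction' with
  | zero => simp only [map_zero]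
  | add x y _ _ hx hy => simp only [map_add, hx, hy]
  | mem i x hx =>
    obtain ⟨z, hz, rfl⟩ := SymLieKaehler.exists_ofFreePoisson_eq hx
    have hz' : FreePoisson.map f.toLinearMap z ∈ FreePoisson.bideg k B i.1 i.2 :=
      SymmetricAlgebra.mapSemilinear_mem_bideg _ (fun _ _ hm => FreeLie.map_mem_deg _ _ hm) _ hz
    rw [SymLieKaehler.map_ofFreePoisson, comparison_ofFreePoisson hz', comparison_ofFreePoisson hz]
    exact (AssocGraded.map_cls (PoissonEnvelope.map f).toAddMonoidHom
      (PoissonEnvelope.map_mem_filt f) i.1 ⟨proj k A z, proj_mem_filt_of_mem_bideg hz⟩).symm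

theorem comparison_nested (a b : A) (l : List A) :
    comparison k A (SymmetricAlgebra.ι A (FreeLie.plus A Ω[A⁄k])
        ⟨FreeLie.nested (KaehlerDifferential.D k A) a (b :: l),
          FreeLie.nested_mem_plus _ a b l⟩) =
      cls (filt k A) 1 ⟨nested k a (b :: l), nested_mem_filt a b l⟩ := by
  have hdeg := FreeLie.nested_mem_deg (R := k) (id : A → A) a (b :: l)
  have hz : SymmetricAlgebra.ι k _ (FreeLie.nested (R := k) (id : A → A) a (b :: l)) ∈
      FreePoisson.bideg k A 1 (b :: l).length := SymmetricAlgebra.ι_mem_bideg (by simp) hdeg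
  have h := comparison_ofFreePoisson hz
  rw [SymLieKaehler.ofFreePoisson_ι_of_mem hdeg] at h
  simp only [FreeLie.map_nested] at h
  refine Eq.trans h ?_
  exact congrArg _ (Subtype.ext (nested_eq a (b :: l)).symm)

end

end GrPoissonEnvelope

/-! ### Injectivity for formally smooth algebras -/

namespace PoissonAlgebra

/-- Each `{a, ·}` is a derivation that preserves `I`, hence preserves its powers. -/
theorem IsPoissonIdeal.pow {k P : Type*} [CommRing k] [CommRing P] [Algebra k P]
    [PoissonAlgebra k P] {I : Ideal P} (hI : IsPoissonIdeal k I) (n : ℕ) :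
    IsPoissonIdeal k (I ^ n) := by
  induction n with
  | zero =>
    intro a x _
    rw [pow_zero, Ideal.one_eq_top]
    trivial
  | succ n ih =>
    intro a x hx
    rw [pow_succ] at hx ⊢
    induction hx using Submodule.mul_induction_on' with
    | mem_mul_mem x hx y hy =>
      rw [leibniz]
      exact add_mem (Ideal.mul_mem_mul (ih a x hx) hy) (Ideal.mul_mem_mul hx (hI a y hy))
    | add x _ y _ hx hy =>
      rw [map_add]
      exact add_mem hx hy

end PoissonAlgebra

theorem RingHom.map_mem_pow {R S : Type*} [CommRing R] [CommRing S] (f : R →+* S) {I : Ideal R}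
    {J : Ideal S} (h : ∀ x ∈ I, f x ∈ J) (n : ℕ) {x : R} (hx : x ∈ I ^ n) : f x ∈ J ^ n :=
  Ideal.le_comap_pow f n (Ideal.pow_right_mono (show I ≤ J.comap f from h) n hx)

namespace SymmetricAlgebra

theorem map_lieBracket {k A 𝔤 𝔥 : Type*} [CommRing k] [LieRing 𝔤] [LieAlgebra k 𝔤] [CommRing A]
    [LieRing 𝔥] [LieAlgebra A 𝔥] (f : SymmetricAlgebra k 𝔤 →+* SymmetricAlgebra A 𝔥) (σ : k →+* A)
    (hσ : ∀ r, f (algebraMap k _ r) = algebraMap A _ (σ r))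
    (h : ∀ x y : 𝔤, f (ι k 𝔤 ⁅x, y⁆) = lieBracket (f (ι k 𝔤 x)) (f (ι k 𝔤 y)))
    (x y : SymmetricAlgebra k 𝔤) : f (lieBracket x y) = lieBracket (f x) (f y) := by
  induction x using SymmetricAlgebra.induction with
  | algebraMap r => rw [lieBracket_algebraMap_left, hσ, lieBracket_algebraMap_left, map_zero]
  | ι x =>
    induction y using SymmetricAlgebra.induction with
    | algebraMap r => rw [lieBracket_algebraMap_right, hσ, lieBracket_algebraMap_right, map_zero]
    | ι y => rw [lieBracket_ι, h]
    | mul a b ha hb =>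
      rw [lieBracket_mul_right, map_add, map_mul, map_mul, ha, hb, map_mul, lieBracket_mul_right]
    | add a b ha hb => rw [map_add, map_add, ha, hb, map_add, map_add]
  | mul a b ha hb =>
    rw [lieBracket_mul_left, map_add, map_mul, map_mul, ha, hb, map_mul, lieBracket_mul_left]
  | add a b ha hb =>
    rw [map_add, LinearMap.add_apply, map_add, ha, hb, map_add, map_add, LinearMap.add_apply]

/-! ### The augmentation ideal and symmetric powers -/

section augmentation

variable (R M : Type*) [CommRing R] [AddCommGroup M] [Module R M]

/-- The augmentation ideal of the symmetric algebra. -/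
noncomputable def augIdeal : Ideal (SymmetricAlgebra R M) :=
  RingHom.ker (algebraMapInv : SymmetricAlgebra R M →ₐ[R] R)

variable {R M}

theorem ι_mem_augIdeal (m : M) : ι R M m ∈ augIdeal R M := algebraMapInv_ι m

/-- The bracket of two generators is again a generator, so every bracket has augmentation zero. -/
theorem isPoissonIdeal_augIdeal {𝔤 : Type*} [LieRing 𝔤] [LieAlgebra R 𝔤] :
    PoissonAlgebra.IsPoissonIdeal R (augIdeal R 𝔤) := by
  intro a x _
  exact map_lieBracket_eq_zero
    ((algebraMapInv : SymmetricAlgebra R 𝔤 →ₐ[R] R) : SymmetricAlgebra R 𝔤 →+* R)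
    (fun _ _ => algebraMapInv_ι _) a x

open Polynomial in
/-- The coaction that encodes the grading of `S(M)` by symmetric powers. -/
noncomputable def powerCoaction : SymmetricAlgebra R M →ₐ[R] (SymmetricAlgebra R M)[X] :=
  lift (((monomial 1 : SymmetricAlgebra R M →ₗ[SymmetricAlgebra R M]
    (SymmetricAlgebra R M)[X]).restrictScalars R) ∘ₗ ι R M)

open Polynomial in
theorem powerCoaction_ι (m : M) : powerCoaction (ι R M m) = monomial 1 (ι R M m) :=
  lift_ι_apply _ m

open Polynomial in
theorem powerCoaction_of_mem_bideg {𝓜 : ℕ → Submodule R M} {p q : ℕ} {x : SymmetricAlgebra R M}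
    (hx : x ∈ bideg 𝓜 (fun _ => 1) p q) : powerCoaction x = monomial p x := by
  refine bideg_induction (motive := fun p q x => powerCoaction x = monomial p x) ?_ ?_ ?_ ?_ ?_ hx
  · intro p q
    rw [map_zero, map_zero]
  · rw [map_one, monomial_zero_one]
  · intro d m hm p q y _ h
    rw [map_mul, h, powerCoaction_ι, monomial_mul_monomial]
  · intro p q x y hx hy
    rw [map_add, map_add, hx, hy]
  · intro p q r x h
    rw [map_smul, h, smul_monomial]

open Polynomial in
-- The constant coefficient of the coaction is the augmentation.
theorem X_dvd_powerCoaction {x : SymmetricAlgebra R M} (hx : x ∈ augIdeal R M) :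
    X ∣ powerCoaction x := by
  rw [X_dvd_iff]
  have key (x : SymmetricAlgebra R M) :
      (powerCoaction x).coeff 0 = algebraMap R _ (algebraMapInv x) := by
    induction x using SymmetricAlgebra.induction with
    | algebraMap r => simp [algebraMap_leftInverse M r, Polynomial.algebraMap_apply]
    | ι m => simp [powerCoaction_ι, coeff_monomial, algebraMapInv_ι]
    | mul x y hx hy => rw [map_mul, mul_coeff_zero, hx, hy, map_mul, map_mul]
    | add x y hx hy => rw [map_add, coeff_add, hx, hy, map_add, map_add]
  rw [key, show algebraMapInv x = 0 from hx, map_zero]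

open Polynomial in
-- The coaction turns `x` into `x X ^ p`, while it sends the power `p + 1` of the augmentation ideal
-- to multiples of `X ^ (p + 1)`.
theorem eq_zero_of_mem_bideg_of_mem_augIdeal_pow {𝓜 : ℕ → Submodule R M} {p q : ℕ}
    {x : SymmetricAlgebra R M} (hx : x ∈ bideg 𝓜 (fun _ => 1) p q)
    (h : x ∈ augIdeal R M ^ (p + 1)) : x = 0 := by
  have h1 := RingHom.map_mem_pow
    ((powerCoaction : SymmetricAlgebra R M →ₐ[R] (SymmetricAlgebra R M)[X]) :
      SymmetricAlgebra R M →+* (SymmetricAlgebra R M)[X])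
    (J := Ideal.span {X}) (fun y hy => Ideal.mem_span_singleton.2 (X_dvd_powerCoaction hy)) _ h
  rw [Ideal.span_singleton_pow, Ideal.mem_span_singleton, X_pow_dvd_iff] at h1
  have h2 := h1 p (Nat.lt_succ_self p)
  rwa [RingHom.coe_coe, powerCoaction_of_mem_bideg hx, coeff_monomial_same] at h2

end augmentation

end SymmetricAlgebra

/-! ### Sections provided by formal smoothness -/

namespace PoissonEnvelope

open SymmetricAlgebra in
/-- For a formally smooth algebra, the projection `S A → A` has sections modulo every power of its
kernel. -/
theorem exists_section_symKer_pow (k A : Type*) [Field k] [CommRing A] [Algebra k A]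
    [Algebra.FormallySmooth k A] (n : ℕ) : ∃ s : A →ₗ[k] SymmetricAlgebra k A,
      (∀ a, lift (LinearMap.id : A →ₗ[k] A) (s a) = a) ∧
        ∀ x ∈ symKer k A, lift s x ∈ symKer k A ^ (n + 1) := by
  let π : SymmetricAlgebra k A →ₐ[k] A := lift (LinearMap.id : A →ₗ[k] A)
  let I := symKer k A
  let q : SymmetricAlgebra k A →ₐ[k] SymmetricAlgebra k A ⧸ I ^ (n + 1) := Ideal.Quotient.mkₐ k _
  let g : SymmetricAlgebra k A ⧸ I ^ (n + 1) →ₐ[k] A :=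
    Ideal.Quotient.liftₐ (I ^ (n + 1)) π fun x hx => Ideal.pow_le_self n.succ_ne_zero hx
  have hg (x) : g (q x) = π x := rfl
  have hsurj : Function.Surjective g := fun a => ⟨q (ι k A a), lift_ι_apply _ a⟩
  -- The kernel of `S A / I ^ (n + 1) → A` is the image of `I`, so its power `n + 1` is zero.
  have hnil : IsNilpotent (RingHom.ker (g : SymmetricAlgebra k A ⧸ I ^ (n + 1) →+* A)) := by
    refine ⟨n + 1, ?_⟩
    have hle : RingHom.ker (g : SymmetricAlgebra k A ⧸ I ^ (n + 1) →+* A) ≤ I.map q := by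
      intro x hx
      obtain ⟨x, rfl⟩ := Ideal.Quotient.mk_surjective x
      exact Ideal.mem_map_of_mem q hx
    rw [Ideal.zero_eq_bot, eq_bot_iff]
    refine (Ideal.pow_right_mono hle _).trans ?_
    rw [← Ideal.map_pow, Ideal.map_le_iff_le_comap]
    intro x hx
    exact Ideal.Quotient.eq_zero_iff_mem.2 hx
  -- Formal smoothness lifts the identity of `A` to an algebra section `σ` modulo `I ^ (n + 1)`.
  -- Over a field, `σ` lifts further to a linear map `s` into `S A`.
  let σ := Algebra.FormallySmooth.liftOfSurjective (AlgHom.id k A) g hsurj hnil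
  have hσ (a) : g (σ a) = a := Algebra.FormallySmooth.liftOfSurjective_apply _ _ hsurj hnil a
  obtain ⟨s, hs⟩ := Module.projective_lifting_property q.toLinearMap σ.toLinearMap
    Ideal.Quotient.mk_surjective
  have hs' (a) : q (s a) = σ a := LinearMap.congr_fun hs a
  refine ⟨s, fun a => ?_, fun x hx => ?_⟩
  · exact (hg _).symm.trans ((congrArg g (hs' a)).trans (hσ a))
  -- Modulo `I ^ (n + 1)`, the extension of `s` is `σ` after the projection `π`, since both are
  -- algebra homomorphisms that agree on `A`; and `π` kills `I`.
  · have e : q.comp (lift s) = σ.comp π := by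
      apply algHom_ext
      ext a
      simp [hs', π]
    have h1 : q (lift s x) = σ (π x) := DFunLike.congr_fun e x
    rw [show π x = 0 from hx, map_zero] at h1
    exact Ideal.Quotient.eq_zero_iff_mem.1 h1

end PoissonEnvelope

/-! ### Poisson endomorphisms of the free Poisson algebra -/

namespace FreePoisson

open SymmetricAlgebra

variable {k A : Type*} [CommRing k] [CommRing A] [Algebra k A]

/-- The endomorphism of the free Poisson algebra that extends a linear map `A → S A`. -/
noncomputable def endo (s : A →ₗ[k] SymmetricAlgebra k A) : FreePoisson k A →ₐ[k] FreePoisson k A :=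
  lift ((PoissonAlgebra.AsLie.of k (FreePoisson k A)).symm.toLinearMap ∘ₗ
    (FreeLie.lift ((PoissonAlgebra.AsLie.of k (FreePoisson k A)).toLinearMap ∘ₗ
      (ofSym k A).toLinearMap ∘ₗ s) : FreeLie k A →ₗ[k] PoissonAlgebra.AsLie k (FreePoisson k A)))

variable (s : A →ₗ[k] SymmetricAlgebra k A)

theorem endo_ι_ι (a : A) : endo s (ι k _ (FreeLie.ι k A a)) = ofSym k A (s a) := by
  rw [endo, lift_ι_apply]
  change (PoissonAlgebra.AsLie.of k (FreePoisson k A)).symm (FreeLie.lift _ _) = _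
  rw [FreeLie.lift_ι]
  rfl

theorem endo_ι_lie (x y : FreeLie k A) :
    endo s (ι k _ ⁅x, y⁆) = lieBracket (endo s (ι k _ x)) (endo s (ι k _ y)) := by
  rw [endo, lift_ι_apply, lift_ι_apply, lift_ι_apply]
  change (PoissonAlgebra.AsLie.of k (FreePoisson k A)).symm (FreeLie.lift _ _) = _
  rw [LieHom.map_lie]
  rfl

theorem endo_lieBracket (x y : FreePoisson k A) :
    endo s (lieBracket x y) = lieBracket (endo s x) (endo s y) :=
  map_lieBracket (endo s : FreePoisson k A →+* FreePoisson k A) (RingHom.id k) (endo s).commutes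
    (endo_ι_lie s) x y

theorem endo_ofSym (x : SymmetricAlgebra k A) : endo s (ofSym k A x) = ofSym k A (lift s x) := by
  have : (endo s).comp (ofSym k A) = (ofSym k A).comp (lift s) := by
    apply algHom_ext
    ext a
    change endo s (ofSym k A (ι k A a)) = ofSym k A (lift s (ι k A a))
    rw [ofSym_ι, endo_ι_ι, lift_ι_apply]
  exact DFunLike.congr_fun this x

variable (k A) in
/-- The augmentation ideal of `S L A → A`. -/
noncomputable def augIdeal : Ideal (FreePoisson k A) := RingHom.ker (aug k A)

/-- The augmentation ideal is a Poisson ideal, hence so are its powers and their preimages under the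
Poisson endomorphism. It is therefore enough to look at the generators in `I A`, where the
hypothesis on `s` applies. -/
theorem endo_mem_augIdeal_pow {n : ℕ}
    (hs : ∀ x ∈ PoissonEnvelope.symKer k A, lift s x ∈ PoissonEnvelope.symKer k A ^ n)
    {x : FreePoisson k A} (hx : x ∈ PoissonEnvelope.ideal k A) :
    endo s x ∈ augIdeal k A ^ n := by
  have hP : PoissonAlgebra.IsPoissonIdeal k (augIdeal k A) := fun a x _ => aug_lieBracket a x
  have h : PoissonEnvelope.ideal k A ≤ (augIdeal k A ^ n).comap (endo s) := by
    refine PoissonAlgebra.poissonSpan_le k (fun a x hx => ?_) ?_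
    · rw [Ideal.mem_comap] at hx ⊢
      have := hP.pow n (endo s a) _ hx
      exact (endo_lieBracket s a x).symm ▸ this
    · rintro _ ⟨x, hx, rfl⟩
      change endo s (ofSym k A x) ∈ augIdeal k A ^ n
      rw [endo_ofSym]
      exact RingHom.map_mem_pow (ofSym k A : SymmetricAlgebra k A →+* FreePoisson k A)
        (fun y hy => (aug_ofSym y).trans hy) n (hs x hx)
  exact h hx

end FreePoisson

/-! ### Leading terms are unchanged by a section -/

namespace SymLieKaehler

open SymmetricAlgebra

variable {k A : Type*} [CommRing k] [CommRing A] [Algebra k A]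

/-- Scalars from `A` are central, so the bracket of `a + da` and `b + db` is `[da, db]`. The degree
`0` part `da` must be kept here: the projection to `L_+` discards it and does not respect brackets.
-/
theorem ofFreePoissonFull_lieBracket (x y : FreePoisson k A) :
    ofFreePoissonFull k A (lieBracket x y) =
      lieBracket (ofFreePoissonFull k A x) (ofFreePoissonFull k A y) := by
  refine map_lieBracket _ (algebraMap k A) ofFreePoissonFull_algebraMap (fun x y => ?_) x y
  simp only [ofFreePoissonFull_ι, FreeLie.counit_lie, FreeLie.map_lie, map_zero, zero_add, map_add,
    LinearMap.add_apply, lieBracket_algebraMap_left, lieBracket_algebraMap_right, lieBracket_ι]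

/-- The Taylor expansion to first order. -/
theorem ofFreePoissonFull_ofSym (x : SymmetricAlgebra k A) :
    ofFreePoissonFull k A (FreePoisson.ofSym k A x) -
      (algebraMap A _ (lift (LinearMap.id : A →ₗ[k] A) x) + ι A _ (FreeLie.ι A Ω[A⁄k]
        (KaehlerDifferential.D k A (lift (LinearMap.id : A →ₗ[k] A) x)))) ∈
      augIdeal A (FreeLie A Ω[A⁄k]) ^ 2 := by
  induction x using SymmetricAlgebra.induction with
  | algebraMap r =>
    rw [AlgHom.commutes, AlgHom.commutes, ofFreePoissonFull_algebraMap, Derivation.map_algebraMap,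
      map_zero, map_zero, add_zero, sub_self]
    exact zero_mem _
  | ι a =>
    rw [FreePoisson.ofSym_ι, ofFreePoissonFull_ι, lift_ι_apply, FreeLie.counit_ι, FreeLie.map_ι,
      LinearMap.id_apply, kaehlerD_apply, sub_self]
    exact zero_mem _
  | mul x y hx hy =>
    have h := Ideal.mul_mem_mul
      (ι_mem_augIdeal (R := A) (FreeLie.ι A Ω[A⁄k]
        (KaehlerDifferential.D k A (lift (LinearMap.id : A →ₗ[k] A) x))))
      (ι_mem_augIdeal (R := A) (FreeLie.ι A Ω[A⁄k]
        (KaehlerDifferential.D k A (lift (LinearMap.id : A →ₗ[k] A) y))))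
    rw [← sq] at h
    rw [map_mul, map_mul, map_mul, Derivation.leibniz, map_add, map_smul, map_smul, map_add,
      map_smul, map_smul, map_mul, Algebra.smul_def, Algebra.smul_def]
    generalize ofFreePoissonFull k A (FreePoisson.ofSym k A x) = X at *
    generalize ofFreePoissonFull k A (FreePoisson.ofSym k A y) = Y at *
    generalize lift (LinearMap.id : A →ₗ[k] A) x = a at *
    generalize lift (LinearMap.id : A →ₗ[k] A) y = b at *
    generalize ι A (FreeLie A Ω[A⁄k]) (FreeLie.ι A Ω[A⁄k] (KaehlerDifferential.D k A a)) = u at *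
    generalize ι A (FreeLie A Ω[A⁄k]) (FreeLie.ι A Ω[A⁄k] (KaehlerDifferential.D k A b)) = v at *
    -- With first-order parts `a + u` and `b + v`: `XY - (ab + av + bu) = (X - a - u) Y + (a + u) (Y
    -- - b - v) + uv`.
    have := add_mem (add_mem (Ideal.mul_mem_right Y _ hx)
      (Ideal.mul_mem_left _ (algebraMap A _ a + u) hy)) h
    convert this using 1
    ring
  | add x y hx hy =>
    convert add_mem hx hy using 1
    simp only [map_add]
    ring

/-- For a generator `a`, the Taylor expansion of `s a` is `a + da` to first order, because `s` is a
section. Brackets preserve the congruence since the square of the augmentation ideal is a Poisson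
ideal. -/
theorem ofFreePoissonFull_endo_ι {s : A →ₗ[k] SymmetricAlgebra k A}
    (hs : ∀ a, lift (LinearMap.id : A →ₗ[k] A) (s a) = a) (x : FreeLie k A) :
    ofFreePoissonFull k A (FreePoisson.endo s (ι k _ x)) - ofFreePoissonFull k A (ι k _ x) ∈
      augIdeal A (FreeLie A Ω[A⁄k]) ^ 2 := by
  induction x using FreeLie.induction with
  | ι a =>
    have := ofFreePoissonFull_ofSym (s a)
    rw [FreePoisson.endo_ι_ι, ofFreePoissonFull_ι, FreeLie.counit_ι, FreeLie.map_ι, kaehlerD_apply]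
    rwa [hs] at this
  | add x y hx hy =>
    convert add_mem hx hy using 1
    simp only [map_add]
    ring
  | smul r x hx =>
    convert Ideal.mul_mem_left _ (algebraMap A _ (algebraMap k A r)) hx using 1
    rw [map_smul, map_smul, Algebra.smul_def, Algebra.smul_def, map_mul, map_mul,
      ofFreePoissonFull_algebraMap, mul_sub]
  | lie x y hx hy =>
    rw [FreePoisson.endo_ι_lie, ← lieBracket_ι, ofFreePoissonFull_lieBracket,
      ofFreePoissonFull_lieBracket]
    exact Ideal.Quotient.eq.1
      (PoissonAlgebra.mk_bracket_eq A (isPoissonIdeal_augIdeal.pow 2) hx hy)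

/-- The augmentations to `A` are compatible, so powers of the augmentation ideal of `S L A` go to
powers of `J`. -/
theorem algebraMapInv_ofFreePoisson (x : FreePoisson k A) :
    algebraMapInv (ofFreePoisson k A x) = FreePoisson.aug k A x := by
  induction x using SymmetricAlgebra.induction with
  | algebraMap r => rw [ofFreePoisson_algebraMap, AlgHom.commutes, AlgHom.commutes]; rfl
  | ι x =>
    rw [ofFreePoisson_ι, map_add, AlgHom.commutes, algebraMapInv_ι, add_zero, FreePoisson.aug_ι]
    rfl
  | mul x y hx hy => rw [map_mul, map_mul, hx, hy, map_mul]
  | add x y hx hy => rw [map_add, map_add, hx, hy, map_add]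

theorem ofFull_mem_augIdeal {x : SymmetricAlgebra A (FreeLie A Ω[A⁄k])}
    (hx : x ∈ augIdeal A (FreeLie A Ω[A⁄k])) :
    ofFull k A x ∈ augIdeal A (FreeLie.plus A Ω[A⁄k]) := by
  have : algebraMapInv.comp (ofFull k A) = algebraMapInv := by
    apply algHom_ext
    ext m
    simp [ofFull, algebraMapInv_ι]
  exact (DFunLike.congr_fun this x).trans hx

/-- A factor of weight `w`, equal to `0` or `1`, lies in `J ^ w` and is changed only by `J ^ (w +
1)`; this property is stable under products. For both weights it suffices that the change of a
generator lies in `J ^ 2`. -/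
theorem ofFreePoisson_endo_sub_mem {s : A →ₗ[k] SymmetricAlgebra k A}
    (hs : ∀ a, lift (LinearMap.id : A →ₗ[k] A) (s a) = a) {p q : ℕ} {x : FreePoisson k A}
    (hx : x ∈ FreePoisson.bideg k A p q) :
    ofFreePoisson k A x ∈ augIdeal A (FreeLie.plus A Ω[A⁄k]) ^ p ∧
      ofFreePoisson k A (FreePoisson.endo s x) - ofFreePoisson k A x ∈
        augIdeal A (FreeLie.plus A Ω[A⁄k]) ^ (p + 1) := by
  set J := augIdeal A (FreeLie.plus A Ω[A⁄k])
  have hι (x : FreeLie k A) : ofFreePoisson k A (FreePoisson.endo s (ι k _ x)) -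
      ofFreePoisson k A (ι k _ x) ∈ J ^ 2 := by
    have := RingHom.map_mem_pow (ofFull k A : _ →+* SymLieKaehler k A)
      (fun _ h => ofFull_mem_augIdeal h) 2 (ofFreePoissonFull_endo_ι hs x)
    rwa [map_sub] at this
  refine bideg_induction (motive := fun p _ x => ofFreePoisson k A x ∈ J ^ p ∧
    ofFreePoisson k A (FreePoisson.endo s x) - ofFreePoisson k A x ∈ J ^ (p + 1)) ?_ ?_ ?_ ?_ ?_ hx
  · intro p q
    rw [map_zero, map_zero, map_zero, sub_self]
    exact ⟨zero_mem _, zero_mem _⟩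
  · rw [map_one, map_one, map_one, sub_self]
    exact ⟨by simp, zero_mem _⟩
  · rintro d m hm p q y - ⟨h1, h2⟩
    have hm1 : ofFreePoisson k A (ι k _ m) ∈ J ^ (if d = 0 then 0 else 1) := by
      obtain _ | d := d
      · simp
      · rw [if_neg d.succ_ne_zero, pow_one, ofFreePoisson_ι_of_mem hm]
        exact ι_mem_augIdeal _
    have hm2 : ofFreePoisson k A (FreePoisson.endo s (ι k _ m)) - ofFreePoisson k A (ι k _ m) ∈
        J ^ ((if d = 0 then 0 else 1) + 1) :=
      Ideal.pow_le_pow_right (by split_ifs <;> omega) (hι m)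
    have hy : ofFreePoisson k A (FreePoisson.endo s y) ∈ J ^ p := by
      rw [← sub_add_cancel (ofFreePoisson k A (FreePoisson.endo s y)) (ofFreePoisson k A y)]
      exact add_mem (Ideal.pow_le_pow_right p.le_succ h2) h1
    refine ⟨?_, ?_⟩
    · rw [map_mul, pow_add]
      exact Ideal.mul_mem_mul hm1 h1
    -- With primes for the effect of the endomorphism: `m'y' - my = (m' - m) y' + m (y' - y)`.
    · have e1 := Ideal.mul_mem_mul hm2 hy
      have e2 := Ideal.mul_mem_mul hm1 h2
      rw [← pow_add] at e1 e2
      rw [add_right_comm] at e1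
      convert add_mem e1 e2 using 1
      rw [map_mul, map_mul, map_mul]
      ring
  · rintro p q x y ⟨h1, h2⟩ ⟨h3, h4⟩
    refine ⟨by rw [map_add]; exact add_mem h1 h3, ?_⟩
    convert add_mem h2 h4 using 1
    simp only [map_add]
    ring
  · rintro p q r x ⟨h1, h2⟩
    rw [(FreePoisson.endo s).map_smul_of_tower, ofFreePoisson_smul, ofFreePoisson_smul, ← smul_sub]
    exact ⟨Submodule.smul_of_tower_mem _ _ h1, Submodule.smul_of_tower_mem _ _ h2⟩

theorem ofFreePoisson_endo_mem_of_mem_filt {s : A →ₗ[k] SymmetricAlgebra k A}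
    (hs : ∀ a, lift (LinearMap.id : A →ₗ[k] A) (s a) = a) {n : ℕ} {x : FreePoisson k A}
    (hx : x ∈ FreePoisson.filt k A n) :
    ofFreePoisson k A (FreePoisson.endo s x) ∈ augIdeal A (FreeLie.plus A Ω[A⁄k]) ^ n := by
  have h : FreePoisson.filt k A n ≤ ((augIdeal A (FreeLie.plus A Ω[A⁄k]) ^ n).comap
      ((ofFreePoisson k A).comp (FreePoisson.endo s : FreePoisson k A →+* FreePoisson k A))
      ).restrictScalars k := by
    refine FreePoisson.filt_le fun p q hp x hx => ?_
    obtain ⟨h1, h2⟩ := ofFreePoisson_endo_sub_mem hs hx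
    change ofFreePoisson k A (FreePoisson.endo s x) ∈ augIdeal A (FreeLie.plus A Ω[A⁄k]) ^ n
    rw [← sub_add_cancel (ofFreePoisson k A (FreePoisson.endo s x)) (ofFreePoisson k A x)]
    exact add_mem (Ideal.pow_le_pow_right (hp.trans p.le_succ) h2) (Ideal.pow_le_pow_right hp h1)
  exact h hx

end SymLieKaehler

/-! ### Injectivity of the comparison map -/

namespace GrPoissonEnvelope

open PoissonEnvelope AssocGraded

variable {k A : Type*} [Field k] [CommRing A] [Algebra k A] [Algebra.FormallySmooth k A]

/-- The lift `z` of `x` agrees in `P A` with some `y` in step `p + 1` of the filtration. A section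
adapted to the power `p + 1` makes the error `z - y` invisible modulo `J ^ (p + 1)`, so `x` itself
lies in that power. -/
theorem eq_zero_of_comparison_eq_zero {p q : ℕ} {x : SymLieKaehler k A}
    (hx : x ∈ SymLieKaehler.bideg k A p q) (h : comparison k A x = 0) : x = 0 := by
  obtain ⟨z, hz, rfl⟩ := SymLieKaehler.exists_ofFreePoisson_eq hx
  refine SymmetricAlgebra.eq_zero_of_mem_bideg_of_mem_augIdeal_pow hx ?_
  rw [comparison_ofFreePoisson hz] at h
  obtain ⟨y, hy, hyz⟩ := eq_zero_of_cls_eq_zero h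
  obtain ⟨s, hs, hs'⟩ := exists_section_symKer_pow k A p
  have h1 := SymLieKaehler.ofFreePoisson_endo_mem_of_mem_filt hs hy
  have hu : z - y ∈ PoissonEnvelope.ideal k A := by
    rw [← proj_eq_zero, map_sub, hyz, sub_self]
  have h2 := RingHom.map_mem_pow (SymLieKaehler.ofFreePoisson k A)
    (J := SymmetricAlgebra.augIdeal A (FreeLie.plus A Ω[A⁄k]))
    (fun w hw => (SymLieKaehler.algebraMapInv_ofFreePoisson w).trans hw) _
    (FreePoisson.endo_mem_augIdeal_pow s hs' hu)
  have h3 := (SymLieKaehler.ofFreePoisson_endo_sub_mem hs hz).2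
  -- With `E` for `endo s` and images taken under `ofFreePoisson`: `z = E y + E (z - y) - (E z -
  -- z)`, and each of the three terms lies in `J ^ (p + 1)`.
  convert sub_mem (add_mem h1 h2) h3 using 1
  simp only [map_sub]
  ring

variable (k A) in
theorem comparison_injective : Function.Injective (comparison k A) := by
  obtain ⟨_⟩ := nonempty_gradedAlgebra_bideg k A
  obtain ⟨_⟩ := SymmetricAlgebra.nonempty_gradedAlgebra_bideg
    (FreeLie.plusDeg A Ω[A⁄k]) fun _ => 1
  let 𝒮 := fun i : ℕ × ℕ => SymmetricAlgebra.bideg (FreeLie.plusDeg A Ω[A⁄k]) (fun _ => 1) i.1 i.2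
  let 𝒢 := fun i : ℕ × ℕ => bideg k A i.1 i.2
  -- A map that preserves bidegrees commutes with taking components, so each component of an element
  -- of the kernel is in the kernel.
  have key (x : SymLieKaehler k A) (i : ℕ × ℕ) :
      (DirectSum.decompose 𝒢 (comparison k A x) i : GrPoissonEnvelope k A) =
        comparison k A (DirectSum.decompose 𝒮 x i) := by
    induction x using DirectSum.Decomposition.inductionOn 𝒮 with
    | zero => simp
    | @homogeneous j x =>
      have hx : comparison k A x ∈ 𝒢 j := comparison_mem_bideg x.2
      obtain rfl | hij := eq_or_ne j i
      · rw [DirectSum.decompose_of_mem_same 𝒢 hx, DirectSum.decompose_of_mem_same 𝒮 x.2]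
      · rw [DirectSum.decompose_of_mem_ne 𝒢 hx hij, DirectSum.decompose_of_mem_ne 𝒮 x.2 hij,
          map_zero]
    | add x y hx hy =>
      simp only [map_add, DirectSum.decompose_add, DirectSum.add_apply, Submodule.coe_add, hx, hy]
  rw [injective_iff_map_eq_zero]
  intro x hx
  have h0 : DirectSum.decompose 𝒮 x = 0 := by
    refine DFinsupp.ext fun i => Subtype.ext ?_
    refine eq_zero_of_comparison_eq_zero (DirectSum.decompose 𝒮 x i).2 ?_
    rw [← key, hx]
    simp
  exact (DirectSum.decompose 𝒮).injective (h0.trans (DirectSum.decompose_zero 𝒮).symm)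

end GrPoissonEnvelope

theorem theorem1p6 (k : Type v) [Field k] [IsAlgClosed k] [CharZero k] :
    -- both sides are bigraded algebras
    (∀ (A : Type u) [CommRing A] [Algebra k A],
      Nonempty (GradedAlgebra fun i : ℕ × ℕ => SymLieKaehler.bideg k A i.1 i.2) ∧
      Nonempty (GradedAlgebra fun i : ℕ × ℕ => GrPoissonEnvelope.bideg k A i.1 i.2)) ∧
    ∃ φ : ∀ (A : Type u) [CommRing A] [Algebra k A],
        SymLieKaehler k A →ₐ[A] GrPoissonEnvelope k A,
      -- `φ` is surjective
      (∀ (A : Type u) [CommRing A] [Algebra k A], Function.Surjective (φ A)) ∧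
      -- `φ` preserves the bidegree
      (∀ (A : Type u) [CommRing A] [Algebra k A] (p q : ℕ) (x : SymLieKaehler k A),
        x ∈ SymLieKaehler.bideg k A p q → φ A x ∈ GrPoissonEnvelope.bideg k A p q) ∧
      -- `φ` is natural in `A`
      (∀ (A B : Type u) [CommRing A] [Algebra k A] [CommRing B] [Algebra k B] (f : A →ₐ[k] B)
        (x : SymLieKaehler k A),
        φ B (SymLieKaehler.map f x) = GrPoissonEnvelope.map f (φ A x)) ∧
      -- `φ` sends `[da, [db, […]]]` to the class of `{a, {b, {…}}}`
      (∀ (A : Type u) [CommRing A] [Algebra k A] (a b : A) (l : List A),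
        φ A (SymmetricAlgebra.ι A (FreeLie.plus A Ω[A⁄k])
            ⟨FreeLie.nested (KaehlerDifferential.D k A) a (b :: l),
              FreeLie.nested_mem_plus _ a b l⟩) =
          AssocGraded.cls (PoissonEnvelope.filt k A) 1
            ⟨PoissonEnvelope.nested k a (b :: l), PoissonEnvelope.nested_mem_filt a b l⟩) ∧
      -- `φ` is an isomorphism if `A` is smooth: formally smooth and essentially of finite type
      (∀ (A : Type u) [CommRing A] [Algebra k A] [Algebra.FormallySmooth k A]
        [Algebra.EssFiniteType k A], Function.Bijective (φ A)) := by
  refine ⟨fun A _ _ => ⟨SymmetricAlgebra.nonempty_gradedAlgebra_bideg _ _,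
    GrPoissonEnvelope.nonempty_gradedAlgebra_bideg k A⟩,
    fun A _ _ => GrPoissonEnvelope.comparison k A,
    fun A _ _ => GrPoissonEnvelope.comparison_surjective k A,
    fun A _ _ p q x hx => GrPoissonEnvelope.comparison_mem_bideg hx,
    fun A B _ _ _ _ f x => GrPoissonEnvelope.comparison_map f x,
    fun A _ _ a b l => GrPoissonEnvelope.comparison_nested a b l,
    fun A _ _ _ _ => ⟨GrPoissonEnvelope.comparison_injective k A,
      GrPoissonEnvelope.comparison_surjective k A⟩⟩
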